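/- \textbf{Conventions.} Let $\Sigma$ be a finite totally ordered alphabet, and order $\Sigma^*$ lexicographically: $u<_\ell v$ iff $u$ is a proper prefix of $v$, or $u<_s v$, where $u<_s v$ means $u=u_1au_2$, $v=u_1bv_2$ with letters $a<b$ (here $v$ may also be an infinite word). For a language $L\subseteq\Sigma^*$ well-ordered by $<_\ell$, $o(L)$ denotes its order type; for an ordinal $o\neq 0$, $\deg(o)$ is the largest exponent in the Cantor normal form of $o$. Ordinal product and power are the usual ones, with $\alpha\times(\beta+1)=\alpha\times\beta+\alpha$. Let $G=(N,\Sigma,P,S)$ be a context-free grammar. For a sentential form $\boldsymbol\alpha\in(N\cup\Sigma)^*$ let $L(\boldsymbol\alpha)$ be the set of terminal words derivable from it. For $X,Y\in N\cup\Sigma$ write $Y\preceq X$ if $X\Rightarrow^*\boldsymbol\alpha Y\boldsymbol\beta$ for some sentential forms $\boldsymbol\alpha,\boldsymbol\beta$; write $X\approx Y$ if $X\preceq Y$ and $Y\preceq X$, and $Y\prec X$ if $Y\preceq X$ but not $X\approx Y$. A production $X\to X_1\cdots X_n$ is \emph{escaping} if $X_i\prec X$ for all $i$, and a \emph{component production}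 otherwise. A nonterminal $X$ is \emph{recursive} if $X\Rightarrow^+\boldsymbol\alpha X\boldsymbol\beta$ for some $\boldsymbol\alpha,\boldsymbol\beta$. $G$ is an \emph{ordinal grammar} if for every nonterminal $X$ the language $L(X)$ is prefix-free and well-ordered by $<_\ell$. It is in \emph{normal form} if (i) for every nonterminal $X$ there are words $u,v,w\in\Sigma^*$ with $S\Rightarrow^* uXv$ and $X\Rightarrow^* w$; (ii) $L(X)$ is infinite for every nonterminal $X$; (iii) every production has the form $A\to a\boldsymbol\alpha$ with $a\in\Sigma$; (iv) every nonterminal other than $S$ is recursive. \textbf{Theorem.} Let $G$ be an ordinal grammar in normal form and let $X$ be a recursive nonterminal. Then the following maxima exist (all languages concerned being well-ordered): let $o_{\boldsymbol\alpha}$ be the maximum of $o(L(\boldsymbol\alpha))$ over all component productions $X'\to uX''\boldsymbol\alpha$ of $G$ with $u\in\Sigma^*$ and nonterminals $X'\approx X''\approx X$, and let $o_{\boldsymbol\beta}$ be the maximum of $o(L(\boldsymbol\beta))$ over all escaping productions $X'\to\boldsymbol\beta$ of $G$ with $X'\approx X$. Moreover, for each nonterminal $X'\approx X$ there is a nonempty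 word $u_{X'}\in\Sigma^+$ such that $w<_s u_{X'}^{\omega}$ for all $w\in L(X')$, and such that whenever $X'\Rightarrow^+uX'\boldsymbol\alpha$ with $u\in\Sigma^*$ and $\boldsymbol\alpha\in(N\cup\Sigma)^*$, then $u=u_{X'}^k$ for some $k\geq 1$. For every choice of such words $u_{X'}$, the order type of $L(X)$ is \begin{enumerate} \item $(o_{\boldsymbol\alpha})^\omega$, if $o_{\boldsymbol\beta}<(o_{\boldsymbol\alpha})^\omega$; \item $o_{\boldsymbol\beta}$, if $o_{\boldsymbol\beta}\geq(o_{\boldsymbol\alpha})^\omega$, $o_{\boldsymbol\beta}=\omega^{\deg(o_{\boldsymbol\beta})}$, and for each escaping production $X'\to\boldsymbol\beta$ with $X'\approx X$ and $\deg(o(L(\boldsymbol\beta)))=\deg(o_{\boldsymbol\beta})$ the language $u_{X'}^N\Sigma^*\cap L(\boldsymbol\beta)$ is nonempty for infinitely many integers $N\geq 0$; \item $o_{\boldsymbol\beta}\times\omega$, otherwise. \end{enumerate} -/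

import Mathlib

open Ordinal

namespace OrdGrammar

section Words

variable {T : Type*}

/-- The power `v ^ k` of a finite word. -/
def wordPow (v : List T) (k : ℕ) : List T := (List.replicate k v).flatten

/-- The strict ordering `w <_s w'` on finite words: `w = p a s`, `w' = p b s'` for some
letters `a < b`. -/
def StrictLt [LT T] (w w' : List T) : Prop :=
  ∃ (p : List T) (a b : T) (s s' : List T), w = p ++ a :: s ∧ w' = p ++ b :: s' ∧ a < b

/-- `w <_s v ^ ω`. The finite prefixes of the word `v ^ ω` are exactly the prefixes of the finite
powers of `v`, so `w` is strictly below `v ^ ω` iff it is strictly below some finite power. -/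
def StrictLtOmegaPow [LT T] (w v : List T) : Prop := ∃ k : ℕ, StrictLt w (wordPow v k)

end Words

/-- The lexicographic ordering of the language `L` (the order `<` on `List T` is the lexicographic
one, with prefixes being smaller) is a well-ordering of order type `o`. -/
def HasOrderType {T : Type*} [LinearOrder T] (L : Set (List T)) (o : Ordinal) : Prop :=
  ∃ _ : IsWellOrder L (fun v w => v < w), Ordinal.type (fun v w : L => v < w) = o

/-- All members of the family `F` of languages are well-ordered, and `o` is the maximum of their
order types. -/
def IsMaxOrderType {T : Type*} [LinearOrder T] (F : Set (Set (List T))) (o : Ordinal) : Prop :=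
  (∃ L ∈ F, HasOrderType L o) ∧ ∀ L ∈ F, ∃ o' ≤ o, HasOrderType L o'

/-- The degree of a nonzero ordinal: the largest exponent in its Cantor normal form, that is, the
largest `e` with `ω ^ e ≤ o`. -/
noncomputable def deg (o : Ordinal) : Ordinal := Ordinal.log ω o

section Grammar

variable {T : Type*} (G : ContextFreeGrammar T)

/-- The language of terminal words generated by a sentential form. -/
def lang (α : List (Symbol T G.NT)) : Set (List T) :=
  {w | G.Derives α (w.map Symbol.terminal)}

/-- `Y ⪯ X` for grammar symbols: `X ⇒* α Y β` for some sentential forms `α`, `β`. -/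
def SymLe (Y X : Symbol T G.NT) : Prop :=
  ∃ α β : List (Symbol T G.NT), G.Derives [X] (α ++ Y :: β)

/-- `X ≈ Y`: the symbols lie in the same component. -/
def SymEquiv (X Y : Symbol T G.NT) : Prop := SymLe G X Y ∧ SymLe G Y X

/-- `Y ≺ X`: `Y ⪯ X`, but the symbols do not lie in the same component. -/
def SymLt (Y X : Symbol T G.NT) : Prop := SymLe G Y X ∧ ¬ SymEquiv G Y X

/-- Nonterminals lying in the same component. -/
def NtEquiv (X Y : G.NT) : Prop := SymEquiv G (Symbol.nonterminal X) (Symbol.nonterminal Y)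

/-- `X → β` is an escaping production of the grammar. -/
def IsEscaping (X : G.NT) (β : List (Symbol T G.NT)) : Prop :=
  ⟨X, β⟩ ∈ G.rules ∧ ∀ Y ∈ β, SymLt G Y (Symbol.nonterminal X)

/-- `X → β` is a component production of the grammar. -/
def IsComponent (X : G.NT) (β : List (Symbol T G.NT)) : Prop :=
  ⟨X, β⟩ ∈ G.rules ∧ ¬ IsEscaping G X β

/-- `α ⇒⁺ β`: derivation in at least one step. -/
def DerivesPlus (α β : List (Symbol T G.NT)) : Prop := Relation.TransGen G.Produces α β

/-- A nonterminal `X` is recursive if `X ⇒⁺ α X β` for some sentential forms `α`, `β`. -/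
def IsRecursive (X : G.NT) : Prop :=
  ∃ α β : List (Symbol T G.NT),
    DerivesPlus G [Symbol.nonterminal X] (α ++ Symbol.nonterminal X :: β)

/-- Ordinal grammars: each nonterminal generates a prefix-free language whose lexicographic
ordering is a well-ordering. -/
def IsOrdinalGrammar [LinearOrder T] : Prop :=
  ∀ X : G.NT,
    (∃ o : Ordinal, HasOrderType (lang G [Symbol.nonterminal X]) o) ∧
    ∀ v ∈ lang G [Symbol.nonterminal X], ∀ w ∈ lang G [Symbol.nonterminal X], v <+: w → v = w

/-- Normal form of a grammar. -/
structure IsNormalForm : Prop where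
  /-- each nonterminal `X` occurs in a derivation `S ⇒* u X v` with terminal words `u`, `v` -/
  accessible : ∀ X : G.NT, ∃ u v : List T, G.Derives [Symbol.nonterminal G.initial]
    (u.map Symbol.terminal ++ Symbol.nonterminal X :: v.map Symbol.terminal)
  /-- each nonterminal generates some terminal word -/
  productive : ∀ X : G.NT, (lang G [Symbol.nonterminal X]).Nonempty
  /-- each nonterminal generates an infinite language -/
  infinite : ∀ X : G.NT, (lang G [Symbol.nonterminal X]).Infinite
  /-- each production has the form `A → a α` for a terminal symbol `a` -/
  greibach : ∀ r ∈ G.rules, ∃ (a : T) (α : List (Symbol T G.NT)),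
    r.output = Symbol.terminal a :: α
  /-- all nonterminals different from the start symbol are recursive -/
  recursive : ∀ X : G.NT, X ≠ G.initial → IsRecursive G X

/-- The languages `L(α)`, where `X' → u X'' α` is a component production with `u` a terminal word
and `X'`, `X''` nonterminals in the component of `X`. -/
def trailingLangs (X : G.NT) : Set (Set (List T)) :=
  {L | ∃ (X' X'' : G.NT) (u : List T) (α : List (Symbol T G.NT)),
    NtEquiv G X' X ∧ NtEquiv G X'' X ∧
    IsComponent G X' (u.map Symbol.terminal ++ Symbol.nonterminal X'' :: α) ∧
    L = lang G α}

/-- The languages `L(β)`, where `X' → β` is an escaping production and `X'` is a nonterminal in the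
component of `X`. -/
def escapingLangs (X : G.NT) : Set (Set (List T)) :=
  {L | ∃ (X' : G.NT) (β : List (Symbol T G.NT)),
    NtEquiv G X' X ∧ IsEscaping G X' β ∧ L = lang G β}

/-- `v` can serve as the word `u_X` of the recursive nonterminal `X`: it is nonempty,
each `w` in `L(X)` satisfies `w <_s v ^ ω`, and `u` is a positive power of `v` whenever
`X ⇒⁺ u X α` for a terminal word `u` and a sentential form `α`. -/
structure IsLoopWord [LT T] (X : G.NT) (v : List T) : Prop where
  ne_nil : v ≠ []
  lang_lt : ∀ w ∈ lang G [Symbol.nonterminal X], StrictLtOmegaPow w v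
  loop : ∀ (u : List T) (α : List (Symbol T G.NT)),
    DerivesPlus G [Symbol.nonterminal X]
      (u.map Symbol.terminal ++ Symbol.nonterminal X :: α) →
    ∃ k : ℕ, 1 ≤ k ∧ u = wordPow v k

/-- For each escaping production `X' → β` with `X' ≈ X` such that the degree of the order type of
`L(β)` is `d`, the intersection of `L(β)` and `(u X') ^ N Σ*` is nonempty for infinitely many
`N`. -/
def EscapingFollowLoops [LinearOrder T] (X : G.NT) (u : G.NT → List T) (d : Ordinal) : Prop :=
  ∀ (X' : G.NT) (β : List (Symbol T G.NT)) (o : Ordinal),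
    NtEquiv G X' X → IsEscaping G X' β → HasOrderType (lang G β) o → deg o = d →
    {N : ℕ | ∃ w ∈ lang G β, wordPow (u X') N <+: w}.Infinite

end Grammar

end OrdGrammar

namespace OrdGrammar

/-! ### Order types of well-ordered sets; additive indecomposability of powers of `ω`. -/

section OrderType

universe u
variable {α : Type u} [LinearOrder α] {s t : Set α}

/-! Write a, b for the two maxima. In an ordinal grammar concatenation multiplies order types in
reverse order (`otype_concat`), and all nonterminals of a component have the same order type o.

Loops are rigid. If X ⇒⁺ uX…, pumping u shows that every word of L(X) lies strictly below u^ω: a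
word above would start an infinite descent, and a prefix of u^ω would be a proper prefix of a pumped
word (`Loop.strictLtOmegaPow`). Hence any two loop words commute and are powers of one root, which
is the loop word (`exists_isLoopWord`). The same rigidity forces every component production into the
form X' → uX''α with u terminal (`IsComponent.exists_eq`).

Upper bound: every proper initial segment of L(X) consists of words that do not extend some power of
the loop word. Such a set is peeled off along the productions: an escaping production gives a piece
of L(β), and a component production multiplies a smaller set of the same kind by some o(L(α)) ≤ a.
If a^ω ≤ ω^f and the escaping pieces have type below ω^f, indecomposability of ω^f keeps everything
below ω^f, so o ≤ ω^f (`otype_cut_lt`, `otype_le_omega0_opow`). The three cases take ω^f to be a^ω,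
b and b × ω.

Lower bound: a component production gives a × o ≤ o, hence a^ω ≤ o (`opow_omega0_le_otype`), and an
escaping one gives b ≤ o. If a set of type at least ω^deg(b) inside some L(β) stays away from a
power of the loop word, pumping stacks ω copies of it on top of each other, so b × ω ≤ o
(`mul_omega0_le_otype`). Such a set exists exactly when the conditions of the second case fail
although b ≥ a^ω. -/

theorem isWellOrder_of_isWF (h : s.IsWF) : IsWellOrder s (fun v w : s => v < w) :=
  have : WellFoundedLT s := ⟨h⟩
  inferInstance

open scoped Classical in
/-- The order type of a well-ordered set, and `0` for other sets. -/
noncomputable def otype (s : Set α) : Ordinal.{u} :=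
  if h : s.IsWF then @Ordinal.type s (fun v w : s => v < w) (isWellOrder_of_isWF h) else 0

theorem otype_eq (h : s.IsWF) [i : IsWellOrder s (fun v w : s => v < w)] :
    otype s = Ordinal.type (fun v w : s => v < w) := by
  unfold otype
  rw [dif_pos h]

theorem hasOrderType_iff {T : Type u} [LinearOrder T] {L : Set (List T)} {o : Ordinal.{u}} :
    HasOrderType L o ↔ L.IsWF ∧ otype L = o := by
  constructor
  · rintro ⟨i, h⟩
    have hw : L.IsWF := i.wf
    exact ⟨hw, (otype_eq hw).trans h⟩
  · rintro ⟨hw, h⟩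
    have i := isWellOrder_of_isWF hw
    exact ⟨i, (otype_eq hw).symm.trans h⟩

theorem isWF_of_strictMonoOn {β : Type*} [LinearOrder β] {t : Set β} (ht : t.IsWF) {f : α → β}
    (hf : Set.MapsTo f s t) (hm : StrictMonoOn f s) : s.IsWF := by
  have : WellFoundedLT t := ⟨ht⟩
  have hs : StrictMono (hf.restrict f s t) := fun a b h => hm a.2 b.2 h
  have := hs.wellFoundedLT
  exact this.wf

theorem otype_le_of_strictMonoOn {β : Type u} [LinearOrder β] {t : Set β} (ht : t.IsWF) {f : α → β}
    (hf : Set.MapsTo f s t) (hm : StrictMonoOn f s) : otype s ≤ otype t := by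
  have hs := isWF_of_strictMonoOn ht hf hm
  have i := isWellOrder_of_isWF hs
  have j := isWellOrder_of_isWF ht
  rw [otype_eq hs, otype_eq ht]
  exact (RelEmbedding.ofMonotone (hf.restrict f s t)
    fun a b h => hm a.2 b.2 h).ordinal_type_le

theorem otype_mono (ht : t.IsWF) (h : s ⊆ t) : otype s ≤ otype t :=
  otype_le_of_strictMonoOn ht (f := id) h fun _ _ _ _ h => h

theorem otype_eq_of_strictMonoOn_surjOn {β : Type u} [LinearOrder β] {t : Set β} (hs : s.IsWF)
    {f : α → β} (hf : StrictMonoOn f s) (ht : t = f '' s) : t.IsWF ∧ otype t = otype s := by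
  subst ht
  have i := isWellOrder_of_isWF hs
  let e : (fun v w : s => v < w) ≃r (fun v w : f '' s => v < w) := (hf.orderIso f s).toRelIsoLT
  have hw : (f '' s).IsWF := e.symm.toRelEmbedding.isWellOrder.wf
  have j := isWellOrder_of_isWF hw
  refine ⟨hw, ?_⟩
  rw [otype_eq hs, otype_eq hw]
  exact e.symm.ordinalType_congr

theorem otype_pos (hs : s.IsWF) (h : s.Nonempty) : 0 < otype s := by
  have i := isWellOrder_of_isWF hs
  rw [otype_eq hs, pos_iff_ne_zero, Ordinal.type_ne_zero_iff_nonempty]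
  exact h.to_subtype

theorem otype_empty : otype (∅ : Set α) = 0 := by
  have i := isWellOrder_of_isWF (Set.isWF_empty (α := α))
  rw [otype_eq Set.isWF_empty, Ordinal.type_eq_zero_iff_isEmpty]
  infer_instance

theorem otype_inter_Iio (hs : s.IsWF) [i : IsWellOrder s (fun v w : s => v < w)] (a : s) :
    otype (s ∩ Set.Iio (a : α)) = Ordinal.typein (fun v w : s => v < w) a := by
  have hs' : (s ∩ Set.Iio (a : α)).IsWF := hs.mono Set.inter_subset_left
  have j := isWellOrder_of_isWF hs'
  rw [otype_eq hs', ← Ordinal.type_subrel]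
  refine RelIso.ordinalType_congr ⟨⟨fun x => ⟨⟨x.1, x.2.1⟩, x.2.2⟩, fun x => ⟨x.1.1, x.1.2, x.2⟩,
    fun x => rfl, fun x => rfl⟩, ?_⟩
  rintro ⟨x, hx⟩ ⟨y, hy⟩
  rfl

theorem otype_inter_Iio_lt (hs : s.IsWF) {a : α} (ha : a ∈ s) :
    otype (s ∩ Set.Iio a) < otype s := by
  have i := isWellOrder_of_isWF hs
  rw [otype_inter_Iio hs ⟨a, ha⟩, otype_eq hs]
  exact Ordinal.typein_lt_type _ _

theorem exists_otype_inter_Iio_eq (hs : s.IsWF) {o : Ordinal.{u}} (ho : o < otype s) :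
    ∃ a ∈ s, otype (s ∩ Set.Iio a) = o := by
  have i := isWellOrder_of_isWF hs
  rw [otype_eq hs] at ho
  obtain ⟨a, ha⟩ := Ordinal.typein_surj _ ho
  exact ⟨a, a.2, (otype_inter_Iio hs a).trans ha⟩

theorem otype_le_of_forall (hs : s.IsWF) {o : Ordinal.{u}}
    (h : ∀ a ∈ s, otype (s ∩ Set.Iio a) < o) : otype s ≤ o := by
  by_contra! hc
  obtain ⟨a, ha, h'⟩ := exists_otype_inter_Iio_eq hs hc
  exact (h a ha).ne h'

theorem otype_union_of_lt (hs : s.IsWF) (ht : t.IsWF) (h : ∀ a ∈ s, ∀ b ∈ t, a < b) :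
    otype (s ∪ t) = otype s + otype t := by
  have hst := hs.union ht
  have i := isWellOrder_of_isWF hs
  have j := isWellOrder_of_isWF ht
  have k := isWellOrder_of_isWF hst
  rw [otype_eq hs, otype_eq ht, otype_eq hst, ← Ordinal.type_sum_lex]
  symm
  let f : s ⊕ t → (s ∪ t : Set α) :=
    Sum.elim (fun a => ⟨a, .inl a.2⟩) (fun b => ⟨b, .inr b.2⟩)
  have hf : ∀ x y, Sum.Lex (fun v w : s => v < w) (fun v w : t => v < w) x y → f x < f y := by
    rintro (x | x) (y | y) hxy
    · have hxy := Sum.lex_inl_inl.1 hxy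
      exact hxy
    · exact h x x.2 y y.2
    · simp at hxy
    · have hxy := Sum.lex_inr_inr.1 hxy
      exact hxy
  have hsurj : Function.Surjective f := by
    rintro ⟨x, hx | hx⟩
    · exact ⟨.inl ⟨x, hx⟩, rfl⟩
    · exact ⟨.inr ⟨x, hx⟩, rfl⟩
  exact RelIso.ordinalType_congr (RelIso.ofSurjective (RelEmbedding.ofMonotone f hf) hsurj)

theorem otype_split (hs : s.IsWF) (a : α) :
    otype s = otype (s ∩ Set.Iio a) + otype (s ∩ Set.Ici a) := by
  rw [← otype_union_of_lt (s := s ∩ Set.Iio a) (t := s ∩ Set.Ici a)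
    (hs.mono Set.inter_subset_left) (hs.mono Set.inter_subset_left)
    fun x hx y hy => lt_of_lt_of_le hx.2 hy.2, ← Set.inter_union_distrib_left]
  simp [Set.Iio_union_Ici]

/-- The union need not be ordered block by block. Cutting it at the element of rank ω^e × n leaves
an upper part of type at least ω^e, and by `ih` one of the two sets captures a further ω^e there. -/
theorem exists_mul_le_otype_of_union (e : Ordinal.{u})
    (ih : ∀ s t : Set α, s.IsWF → t.IsWF → ω ^ e ≤ otype (s ∪ t) →
      ω ^ e ≤ otype s ∨ ω ^ e ≤ otype t) (n : ℕ) :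
    ∀ s t : Set α, s.IsWF → t.IsWF → ω ^ e * n ≤ otype (s ∪ t) →
      ∃ k l : ℕ, k + l = n ∧ ω ^ e * k ≤ otype s ∧ ω ^ e * l ≤ otype t := by
  induction n with
  | zero => exact fun s t hs ht _ => ⟨0, 0, rfl, by simp, by simp⟩
  | succ n ihn =>
    intro s t hs ht hst
    have hpos : (0 : Ordinal.{u}) < ω ^ e := Ordinal.opow_pos _ Ordinal.omega0_pos
    have hmul : ω ^ e * ((n + 1 : ℕ) : Ordinal) = ω ^ e * n + ω ^ e := by
      rw [Nat.cast_succ, mul_add, mul_one]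
    rw [hmul] at hst
    have hlt : ω ^ e * n < otype (s ∪ t) :=
      lt_of_lt_of_le (lt_add_of_pos_right _ hpos) hst
    obtain ⟨a, ha, hoa⟩ := exists_otype_inter_Iio_eq (hs.union ht) hlt
    rw [otype_split (hs.union ht) a, hoa] at hst
    have hst' := le_of_add_le_add_left hst
    rw [Set.union_inter_distrib_right] at hst' hoa
    obtain ⟨k, l, hkl, hk, hl⟩ := ihn _ _ (hs.mono Set.inter_subset_left)
      (ht.mono Set.inter_subset_left) hoa.ge
    rcases ih _ _ (hs.mono Set.inter_subset_left) (ht.mono Set.inter_subset_left) hst' with h | h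
    · refine ⟨k + 1, l, by omega, ?_, hl.trans (otype_mono ht Set.inter_subset_left)⟩
      rw [Nat.cast_succ, mul_add, mul_one, otype_split hs a]
      exact add_le_add hk h
    · refine ⟨k, l + 1, by omega, hk.trans (otype_mono hs Set.inter_subset_left), ?_⟩
      rw [Nat.cast_succ, mul_add, mul_one, otype_split ht a]
      exact add_le_add hl h

/-- This is indecomposability for arbitrarily interleaved unions, which is what a finite union over
productions needs. -/
theorem le_otype_or_of_le_otype_union (e : Ordinal.{u}) :
    ∀ s t : Set α, s.IsWF → t.IsWF → ω ^ e ≤ otype (s ∪ t) →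
      ω ^ e ≤ otype s ∨ ω ^ e ≤ otype t := by
  induction e using Ordinal.limitRecOn with
  | zero =>
    intro s t hs ht h
    simp only [Ordinal.opow_zero, Order.one_le_iff_pos] at h ⊢
    by_contra! hc
    have h1 : s = ∅ := by
      by_contra hne
      exact (otype_pos hs (Set.nonempty_iff_ne_empty.2 hne)).not_ge hc.1
    have h2 : t = ∅ := by
      by_contra hne
      exact (otype_pos ht (Set.nonempty_iff_ne_empty.2 hne)).not_ge hc.2
    simp [h1, h2, otype_empty] at h
  | add_one e ih =>
    intro s t hs ht h
    by_contra! hc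
    -- If both types were below ω^(e+1), they would be below ω^e × n and ω^e × m, whereas a union of
    -- type at least ω^e × (n + m) distributes n + m copies of ω^e over the two sets.
    obtain ⟨n, hn⟩ := Ordinal.lt_omega0_opow_succ.1 hc.1
    obtain ⟨m, hm⟩ := Ordinal.lt_omega0_opow_succ.1 hc.2
    obtain ⟨k, l, hkl, hk, hl⟩ := exists_mul_le_otype_of_union e ih (n + m) s t hs ht
      ((Ordinal.opow_mul_lt_opow (Ordinal.natCast_lt_omega0 _) (Order.lt_succ e)).le.trans h)
    have h1 : k < n := by
      have := hk.trans_lt hn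
      exact_mod_cast lt_of_mul_lt_mul_left' this
    have h2 : l < m := by
      have := hl.trans_lt hm
      exact_mod_cast lt_of_mul_lt_mul_left' this
    omega
  | limit e he ih =>
    intro s t hs ht h
    by_contra! hc
    obtain ⟨a, ha, h1⟩ := (Ordinal.lt_opow_of_isSuccLimit Ordinal.omega0_ne_zero he).1 hc.1
    obtain ⟨b, hb, h2⟩ := (Ordinal.lt_opow_of_isSuccLimit Ordinal.omega0_ne_zero he).1 hc.2
    have hab : max a b < e := max_lt ha hb
    have hle : ω ^ (max a b) ≤ ω ^ e := Ordinal.opow_le_opow_right Ordinal.omega0_pos hab.le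
    rcases ih _ hab s t hs ht (hle.trans h) with h3 | h3
    · exact (h3.trans_lt h1).not_ge (Ordinal.opow_le_opow_right Ordinal.omega0_pos (le_max_left _ _))
    · exact (h3.trans_lt h2).not_ge
        (Ordinal.opow_le_opow_right Ordinal.omega0_pos (le_max_right _ _))

theorem otype_union_lt {e : Ordinal.{u}} (hs : s.IsWF) (ht : t.IsWF) (h1 : otype s < ω ^ e)
    (h2 : otype t < ω ^ e) : otype (s ∪ t) < ω ^ e := by
  by_contra! h
  rcases le_otype_or_of_le_otype_union e s t hs ht h with h | h
  · exact h1.not_ge h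
  · exact h2.not_ge h

theorem otype_biUnion_lt {ι : Type*} {I : Set ι} (hI : I.Finite) {f : ι → Set α} {e : Ordinal.{u}}
    (hf : ∀ i ∈ I, (f i).IsWF ∧ otype (f i) < ω ^ e) :
    (⋃ i ∈ I, f i).IsWF ∧ otype (⋃ i ∈ I, f i) < ω ^ e := by
  induction I, hI using Set.Finite.induction_on with
  | empty => simpa [otype_empty] using Ordinal.opow_pos e Ordinal.omega0_pos
  | insert _ _ ih =>
    rw [Set.biUnion_insert]
    obtain ⟨h1, h2⟩ := hf _ (Set.mem_insert _ _)
    obtain ⟨h3, h4⟩ := ih fun i hi => hf i (Set.mem_insert_of_mem _ hi)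
    exact ⟨h1.union h3, otype_union_lt h1 h3 h2 h4⟩

end OrderType

end OrdGrammar

namespace OrdGrammar

/-! ### The lexicographic and the strict order on words. -/

section WordOrder

universe u
variable {T : Type u}

theorem StrictLt.append_left [LT T] {w w' : List T} (h : StrictLt w w') (p : List T) :
    StrictLt (p ++ w) (p ++ w') := by
  obtain ⟨q, a, b, s, s', rfl, rfl, hab⟩ := h
  exact ⟨p ++ q, a, b, s, s', by simp, by simp, hab⟩

theorem StrictLt.append_right [LT T] {w w' : List T} (h : StrictLt w w') (x y : List T) :
    StrictLt (w ++ x) (w' ++ y) := by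
  obtain ⟨q, a, b, s, s', rfl, rfl, hab⟩ := h
  exact ⟨q, a, b, s ++ x, s' ++ y, by simp, by simp, hab⟩

theorem StrictLt.of_prefix [LT T] {w w' z z' : List T} (h : StrictLt w w') (hz : w <+: z)
    (hz' : w' <+: z') : StrictLt z z' := by
  obtain ⟨x, rfl⟩ := hz
  obtain ⟨y, rfl⟩ := hz'
  exact h.append_right x y

variable [LinearOrder T]

theorem cons_lt_cons_iff {a b : T} {v w : List T} :
    a :: v < b :: w ↔ a < b ∨ a = b ∧ v < w := by
  constructor
  · intro h
    rcases h with _ | h | h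
    · exact .inl (by assumption)
    · exact .inr ⟨rfl, by assumption⟩
  · rintro (h | ⟨rfl, h⟩)
    · exact List.Lex.rel h
    · exact List.Lex.cons h

theorem lt_iff {v w : List T} : v < w ↔ StrictLt v w ∨ (v <+: w ∧ v ≠ w) := by
  induction v generalizing w with
  | nil =>
    cases w with
    | nil => simp [StrictLt]
    | cons b w =>
      have : ([] : List T) < b :: w := List.Lex.nil
      simp [this]
  | cons a v ih =>
    cases w with
    | nil =>
      have : ¬ (a :: v < []) := fun h => by cases h
      simp [this, StrictLt]
    | cons b w =>
      rw [cons_lt_cons_iff, ih, List.cons_prefix_cons]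
      constructor
      · rintro (h | ⟨rfl, h | ⟨h, hne⟩⟩)
        · exact .inl ⟨[], a, b, v, w, rfl, rfl, h⟩
        · exact .inl (h.append_left [a])
        · exact .inr ⟨⟨rfl, h⟩, by simpa using hne⟩
      · rintro (⟨p, c, d, s, s', h1, h2, hcd⟩ | ⟨⟨rfl, h⟩, hne⟩)
        · cases p with
          | nil =>
            simp only [List.nil_append, List.cons.injEq] at h1 h2
            rw [h1.1, h2.1]
            exact .inl hcd
          | cons e p =>
            simp only [List.cons_append, List.cons.injEq] at h1 h2
            exact .inr ⟨h1.1.trans h2.1.symm, .inl ⟨p, c, d, s, s', h1.2, h2.2, hcd⟩⟩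
        · exact .inr ⟨rfl, .inr ⟨h, by simpa using hne⟩⟩

theorem StrictLt.lt {v w : List T} (h : StrictLt v w) : v < w := lt_iff.2 (.inl h)

theorem le_of_prefix {v w : List T} (h : v <+: w) : v ≤ w := by
  by_cases hne : v = w
  · exact hne.le
  · exact (lt_iff.2 (.inr ⟨h, hne⟩)).le

theorem strictLt_trichotomy (v w : List T) :
    StrictLt v w ∨ StrictLt w v ∨ v <+: w ∨ w <+: v := by
  rcases lt_trichotomy v w with h | rfl | h
  · rcases lt_iff.1 h with h | h
    · exact .inl h
    · exact .inr (.inr (.inl h.1))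
  · exact .inr (.inr (.inl List.prefix_rfl))
  · rcases lt_iff.1 h with h | h
    · exact .inr (.inl h)
    · exact .inr (.inr (.inr h.1))

theorem StrictLt.not_prefix {v w : List T} (h : StrictLt v w) : ¬ v <+: w :=
  fun hp => by
    obtain ⟨q, a, b, s, s', rfl, rfl, hab⟩ := h
    rw [List.prefix_append_right_inj, List.cons_prefix_cons] at hp
    exact hab.ne hp.1

theorem StrictLt.not_prefix' {v w : List T} (h : StrictLt v w) : ¬ w <+: v :=
  fun hp => by
    obtain ⟨q, a, b, s, s', rfl, rfl, hab⟩ := h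
    rw [List.prefix_append_right_inj, List.cons_prefix_cons] at hp
    exact hab.ne hp.1.symm

theorem append_lt_append_left {p v w : List T} (h : v < w) : p ++ v < p ++ w := by
  rcases lt_iff.1 h with h | ⟨h, hne⟩
  · exact (h.append_left p).lt
  · exact lt_iff.2 (.inr ⟨by simpa using h, by simpa using hne⟩)

/-- A word strictly below `w` which does not extend the prefix `t` of `w` is strictly below `t`. -/
theorem StrictLt.of_not_prefix {v w t : List T} (h : StrictLt v w) (ht : t <+: w)
    (hv : ¬ t <+: v) : StrictLt v t := by
  obtain ⟨q, a, b, s, s', rfl, rfl, hab⟩ := h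
  rcases le_or_gt t.length q.length with hl | hl
  · exact absurd ((List.prefix_of_prefix_length_le ht (List.prefix_append _ _) hl).trans
      (List.prefix_append _ _)) hv
  · have hb : q ++ [b] <+: q ++ b :: s' := by simp
    obtain ⟨x, rfl⟩ := List.prefix_of_prefix_length_le hb ht (by simpa using hl)
    exact ⟨q, a, b, s, x, rfl, by simp, hab⟩

end WordOrder

/-! ### Prefix-free languages and their concatenation. -/

section PrefixFree

universe u
variable {T : Type u}

/-- No word of `L` is a proper prefix of another word of `L`. -/
def PrefixFree (L : Set (List T)) : Prop := ∀ v ∈ L, ∀ w ∈ L, v <+: w → v = w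

/-- The concatenation of two languages. -/
def concat (L M : Set (List T)) : Set (List T) := Set.image2 (· ++ ·) L M

theorem PrefixFree.eq_of_append_eq {L : Set (List T)} (h : PrefixFree L) {v w x y : List T}
    (hv : v ∈ L) (hw : w ∈ L) (he : v ++ x = w ++ y) : v = w ∧ x = y := by
  have : v = w := by
    rcases List.prefix_or_prefix_of_prefix (List.prefix_append v x)
      (he ▸ List.prefix_append w y) with h' | h'
    · exact h v hv w hw h'
    · exact (h w hw v hv h').symm
  subst this
  exact ⟨rfl, by simpa using he⟩

theorem PrefixFree.concat {L M : Set (List T)} (hL : PrefixFree L) (hM : PrefixFree M) :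
    PrefixFree (concat L M) := by
  rintro _ ⟨v, hv, x, hx, rfl⟩ _ ⟨w, hw, y, hy, rfl⟩ ⟨z, hz⟩
  simp only [List.append_assoc] at hz
  obtain ⟨rfl, h⟩ := hL.eq_of_append_eq hv hw hz
  rw [hM x hx y hy ⟨z, h⟩]

variable [LinearOrder T]

theorem PrefixFree.strictLt_of_lt {L : Set (List T)} (h : PrefixFree L) {v w : List T}
    (hv : v ∈ L) (hw : w ∈ L) (hlt : v < w) : StrictLt v w := by
  rcases lt_iff.1 hlt with h' | h'
  · exact h'
  · exact absurd (h v hv w hw h'.1) h'.2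

/-- Distinct words of a prefix-free `L` differ at a letter, so the `L`-factor decides the comparison
first. The order is the lexicographic product, which is why the factors appear reversed. -/
theorem otype_concat {L M : Set (List T)} (hL : L.IsWF) (hp : PrefixFree L) (hM : M.IsWF) :
    (concat L M).IsWF ∧ otype (concat L M) = otype M * otype L := by
  have i := isWellOrder_of_isWF hL
  have j := isWellOrder_of_isWF hM
  let f : L × M → concat L M := fun x => ⟨x.1 ++ x.2, x.1, x.1.2, x.2, x.2.2, rfl⟩
  have hf : ∀ x y, Prod.Lex (fun v w : L => v < w) (fun v w : M => v < w) x y ↔ f x < f y := by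
    have key : ∀ x y, Prod.Lex (fun v w : L => v < w) (fun v w : M => v < w) x y → f x < f y := by
      rintro ⟨x, y⟩ ⟨x', y'⟩ h
      rcases Prod.lex_iff.1 h with h | ⟨h, h'⟩
      · exact ((hp.strictLt_of_lt x.2 x'.2 h).append_right _ _).lt
      · obtain rfl : x = x' := h
        exact append_lt_append_left h'
    intro x y
    refine ⟨key x y, fun h => ?_⟩
    rcases trichotomous_of (Prod.Lex (fun v w : L => v < w) (fun v w : M => v < w)) x y
      with h' | rfl | h'
    · exact h'
    · exact (lt_irrefl _ h).elim
    · exact (h.asymm (key _ _ h')).elim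
  have hinj : Function.Injective f := by
    rintro ⟨x, y⟩ ⟨x', y'⟩ h
    obtain ⟨h1, h2⟩ := hp.eq_of_append_eq x.2 x'.2 (congrArg Subtype.val h)
    exact Prod.ext (Subtype.ext h1) (Subtype.ext h2)
  have hsurj : Function.Surjective f := by
    rintro ⟨_, x, hx, y, hy, rfl⟩
    exact ⟨(⟨x, hx⟩, ⟨y, hy⟩), rfl⟩
  let e : Prod.Lex (fun v w : L => v < w) (fun v w : M => v < w) ≃r
      (fun v w : concat L M => v < w) :=
    ⟨Equiv.ofBijective f ⟨hinj, hsurj⟩, fun {x y} => (hf x y).symm⟩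
  have hw : (concat L M).IsWF := e.symm.toRelEmbedding.isWellOrder.wf
  have k := isWellOrder_of_isWF hw
  refine ⟨hw, ?_⟩
  rw [otype_eq hL, otype_eq hM, otype_eq hw, ← Ordinal.type_prod_lex]
  exact e.symm.ordinalType_congr

theorem otype_image_append {M : Set (List T)} (hM : M.IsWF) (p : List T) :
    ((p ++ ·) '' M).IsWF ∧ otype ((p ++ ·) '' M) = otype M :=
  otype_eq_of_strictMonoOn_surjOn hM (fun _ _ _ _ h => append_lt_append_left h) rfl

end PrefixFree

/-! ### Powers of words and commuting words. -/

section WordPow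

variable {T : Type*}

@[simp] theorem wordPow_zero (v : List T) : wordPow v 0 = [] := rfl

theorem wordPow_succ (v : List T) (k : ℕ) : wordPow v (k + 1) = v ++ wordPow v k := by
  simp [wordPow, List.replicate_succ]

@[simp] theorem wordPow_one (v : List T) : wordPow v 1 = v := by simp [wordPow_succ]

theorem wordPow_add (v : List T) (k l : ℕ) : wordPow v (k + l) = wordPow v k ++ wordPow v l := by
  simp only [wordPow, List.replicate_add, List.flatten_append]

theorem wordPow_mul (v : List T) (k l : ℕ) : wordPow v (k * l) = wordPow (wordPow v k) l := by
  induction l with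
  | zero => rfl
  | succ l ih => rw [wordPow_succ, ← ih, ← wordPow_add, Nat.mul_succ, Nat.add_comm]

theorem length_wordPow (v : List T) (k : ℕ) : (wordPow v k).length = k * v.length := by
  simp [wordPow]

theorem wordPow_prefix (v : List T) {k l : ℕ} (h : k ≤ l) : wordPow v k <+: wordPow v l := by
  obtain ⟨m, rfl⟩ := Nat.exists_eq_add_of_le h
  rw [wordPow_add]
  exact List.prefix_append _ _

theorem le_length_wordPow {v : List T} (h : v ≠ []) (k : ℕ) : k ≤ (wordPow v k).length := by
  rw [length_wordPow]
  exact Nat.le_mul_of_pos_right _ (List.length_pos_iff.2 h)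

/-- `t` is a prefix of `v ^ ω`. -/
def PrefixOmega (t v : List T) : Prop := ∃ k, t <+: wordPow v k

theorem prefixOmega_wordPow (v : List T) (k : ℕ) : PrefixOmega (wordPow v k) v :=
  ⟨k, List.prefix_rfl⟩

theorem PrefixOmega.prefix_of_length_le {s t v : List T} (hs : PrefixOmega s v)
    (ht : PrefixOmega t v) (h : s.length ≤ t.length) : s <+: t := by
  obtain ⟨k, hk⟩ := hs
  obtain ⟨l, hl⟩ := ht
  exact List.prefix_of_prefix_length_le (hk.trans (wordPow_prefix v (le_max_left k l)))
    (hl.trans (wordPow_prefix v (le_max_right k l))) h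

theorem StrictLtOmegaPow.strictLt [LinearOrder T] {w t v : List T} (h : StrictLtOmegaPow w v)
    (ht : PrefixOmega t v) (hw : ¬ t <+: w) : StrictLt w t := by
  obtain ⟨k, hk⟩ := h
  obtain ⟨l, hl⟩ := ht
  exact (hk.of_prefix List.prefix_rfl (wordPow_prefix v (le_max_left k l))).of_not_prefix
    (hl.trans (wordPow_prefix v (le_max_right k l))) hw

theorem wordPow_comm {v u : List T} (h : u ++ v = v ++ u) (k : ℕ) :
    u ++ wordPow v k = wordPow v k ++ u := by
  induction k with
  | zero => simp
  | succ k ih => rw [wordPow_succ, ← List.append_assoc, h, List.append_assoc, ih, List.append_assoc]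

theorem prefixOmega_of_comm {v u : List T} (hv : v ≠ []) (h : u ++ v = v ++ u) :
    PrefixOmega u v :=
  ⟨u.length, List.prefix_of_prefix_length_le (List.prefix_append u (wordPow v u.length))
    (wordPow_comm h _ ▸ List.prefix_append _ _) (le_length_wordPow hv _)⟩

/-- Both products commute with x, so they are prefixes of x^ω of the same length. -/
theorem append_comm_trans {u v x : List T} (hx : x ≠ []) (hu : u ++ x = x ++ u)
    (hv : v ++ x = x ++ v) : u ++ v = v ++ u := by
  have h1 : PrefixOmega (u ++ v) x := prefixOmega_of_comm hx (by
    rw [List.append_assoc, hv, ← List.append_assoc, hu, List.append_assoc])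
  have h2 : PrefixOmega (v ++ u) x := prefixOmega_of_comm hx (by
    rw [List.append_assoc, hu, ← List.append_assoc, hv, List.append_assoc])
  have hl : (u ++ v).length = (v ++ u).length := by simp [Nat.add_comm]
  exact (h1.prefix_of_length_le h2 hl.le).eq_of_length hl

/-- The words commuting with a given nonempty word are the powers of a common word. -/
theorem exists_root {x : List T} (hx : x ≠ []) :
    ∃ v : List T, v ≠ [] ∧ ∀ u, u ++ x = x ++ u → ∃ k, u = wordPow v k := by
  classical
  let P : ℕ → Prop := fun n => ∃ v : List T, v ≠ [] ∧ v ++ x = x ++ v ∧ v.length = n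
  have hP : ∃ n, P n := ⟨_, x, hx, rfl, rfl⟩
  obtain ⟨v, hv, hvx, hvl⟩ := Nat.find_spec hP
  -- The root v is a shortest nonempty word commuting with x. Any other such word starts with v, and
  -- the remainder again commutes with x.
  refine ⟨v, hv, fun u => ?_⟩
  induction hn : u.length using Nat.strong_induction_on generalizing u with
  | _ n ih =>
    intro hu
    by_cases h0 : u = []
    · exact ⟨0, h0⟩
    have hle : v.length ≤ u.length := hvl ▸ Nat.find_min' hP ⟨u, h0, hu, rfl⟩
    have huv := append_comm_trans hx hu hvx
    obtain ⟨w, rfl⟩ := List.prefix_of_prefix_length_le (List.prefix_append v u)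
      (huv ▸ List.prefix_append u v) hle
    have hwv : w ++ v = v ++ w := by simpa using huv
    have hpos : 0 < v.length := List.length_pos_iff.2 hv
    obtain ⟨k, rfl⟩ := ih w.length (by simp at hn; omega) w rfl
      (append_comm_trans hv hwv hvx.symm)
    exact ⟨k + 1, (wordPow_succ v k).symm⟩

end WordPow

end OrdGrammar

namespace OrdGrammar

/-! ### Derivations, components and loops. -/

section Derivations

variable {T : Type*} {G : ContextFreeGrammar T}

theorem produces_append_split {α β γ : List (Symbol T G.NT)} (h : G.Produces (α ++ β) γ) :
    (∃ α', G.Produces α α' ∧ γ = α' ++ β) ∨ ∃ β', G.Produces β β' ∧ γ = α ++ β' := by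
  obtain ⟨r, hr, h⟩ := h
  induction α generalizing γ with
  | nil => exact .inr ⟨γ, ⟨r, hr, h⟩, rfl⟩
  | cons x α ih =>
    rw [List.cons_append] at h
    cases h with
    | head => exact .inl ⟨r.output ++ α, ⟨r, hr, .head α⟩, by simp⟩
    | cons _ h =>
      rcases ih h with ⟨α', ⟨r', hr', h'⟩, rfl⟩ | ⟨β', h', rfl⟩
      · exact .inl ⟨x :: α', ⟨r', hr', .cons x h'⟩, rfl⟩
      · exact .inr ⟨β', h', rfl⟩

theorem derives_append_split {α β γ : List (Symbol T G.NT)} (h : G.Derives (α ++ β) γ) :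
    ∃ γ₁ γ₂, γ = γ₁ ++ γ₂ ∧ G.Derives α γ₁ ∧ G.Derives β γ₂ := by
  induction h with
  | refl => exact ⟨α, β, rfl, .refl _, .refl _⟩
  | tail _ h ih =>
    obtain ⟨γ₁, γ₂, rfl, h1, h2⟩ := ih
    rcases produces_append_split h with ⟨δ, hδ, rfl⟩ | ⟨δ, hδ, rfl⟩
    · exact ⟨δ, γ₂, rfl, h1.trans_produces hδ, h2⟩
    · exact ⟨γ₁, δ, rfl, h1, h2.trans_produces hδ⟩

theorem derives_append {α β α' β' : List (Symbol T G.NT)} (h : G.Derives α α')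
    (h' : G.Derives β β') : G.Derives (α ++ β) (α' ++ β') :=
  (h.append_right β).trans (h'.append_left α')

theorem produces_nonterminal_iff {X : G.NT} {γ : List (Symbol T G.NT)} :
    G.Produces [Symbol.nonterminal X] γ ↔ ⟨X, γ⟩ ∈ G.rules := by
  constructor
  · rintro ⟨⟨Y, δ⟩, hr, h⟩
    cases h with
    | head => simpa using hr
    | cons _ h => cases h
  · intro h
    exact ⟨_, h, ContextFreeRule.Rewrites.input_output⟩

theorem derives_terminals {u : List T} {γ : List (Symbol T G.NT)}
    (h : G.Derives (u.map Symbol.terminal) γ) : γ = u.map Symbol.terminal := by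
  rcases h.eq_or_head with h | ⟨δ, h, -⟩
  · exact h.symm
  · obtain ⟨r, -, h⟩ := h.exists_nonterminal_input_mem
    simp at h

theorem map_terminal_injective {N : Type*} :
    Function.Injective (List.map (Symbol.terminal : T → Symbol T N)) :=
  List.map_injective_iff.2 fun _ _ h => by simpa using h

theorem lang_mono {α β : List (Symbol T G.NT)} (h : G.Derives α β) : lang G β ⊆ lang G α :=
  fun _ hw => h.trans hw

theorem lang_terminals (u : List T) : lang G (u.map Symbol.terminal) = {u} := by
  ext w
  constructor
  · intro h
    exact map_terminal_injective (derives_terminals h)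
  · rintro rfl
    exact .refl _

theorem lang_append (α β : List (Symbol T G.NT)) :
    lang G (α ++ β) = concat (lang G α) (lang G β) := by
  ext w
  constructor
  · intro h
    obtain ⟨γ₁, γ₂, he, h1, h2⟩ := derives_append_split h
    obtain ⟨x, y, rfl, rfl, rfl⟩ := List.map_eq_append_iff.1 he
    exact ⟨x, h1, y, h2, rfl⟩
  · rintro ⟨x, hx, y, hy, rfl⟩
    simp only [lang, Set.mem_ofPred_eq, List.map_append]
    exact derives_append hx hy

theorem lang_cons (Y : Symbol T G.NT) (β : List (Symbol T G.NT)) :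
    lang G (Y :: β) = concat (lang G [Y]) (lang G β) :=
  lang_append [Y] β

theorem mem_lang_nonterminal {X : G.NT} {w : List T} :
    w ∈ lang G [Symbol.nonterminal X] ↔ ∃ β, ⟨X, β⟩ ∈ G.rules ∧ w ∈ lang G β := by
  constructor
  · intro h
    rcases ContextFreeGrammar.Derives.eq_or_head h with h | ⟨β, h, h'⟩
    · cases w <;> simp at h
    · exact ⟨β, produces_nonterminal_iff.1 h, h'⟩
  · rintro ⟨β, h, h'⟩
    exact (produces_nonterminal_iff.2 h).trans_derives h'

theorem derives_of_rule {X : G.NT} {β : List (Symbol T G.NT)} (h : ⟨X, β⟩ ∈ G.rules) :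
    DerivesPlus G [Symbol.nonterminal X] β :=
  .single (produces_nonterminal_iff.2 h)

theorem symLe_iff {X Y : Symbol T G.NT} : SymLe G Y X ↔ ∃ γ, G.Derives [X] γ ∧ Y ∈ γ := by
  constructor
  · rintro ⟨α, β, h⟩
    exact ⟨_, h, by simp⟩
  · rintro ⟨γ, h, hY⟩
    obtain ⟨α, β, rfl⟩ := List.append_of_mem hY
    exact ⟨α, β, h⟩

theorem SymLe.refl (X : Symbol T G.NT) : SymLe G X X := ⟨[], [], .refl _⟩

theorem SymLe.trans {X Y Z : Symbol T G.NT} (h : SymLe G Z Y) (h' : SymLe G Y X) :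
    SymLe G Z X := by
  obtain ⟨α, β, h⟩ := h
  obtain ⟨γ, δ, h'⟩ := h'
  refine ⟨γ ++ α, β ++ δ, h'.trans ?_⟩
  simpa using (h.append_right δ).append_left γ

theorem exists_symLe_of_derives {γ δ : List (Symbol T G.NT)} (h : G.Derives γ δ)
    {X : Symbol T G.NT} (hX : X ∈ δ) : ∃ Y ∈ γ, SymLe G X Y := by
  induction γ generalizing δ with
  | nil =>
    rw [derives_terminals (u := []) h] at hX
    simp at hX
  | cons Y γ ih =>
    obtain ⟨δ₁, δ₂, rfl, h1, h2⟩ := derives_append_split (α := [Y]) h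
    rcases List.mem_append.1 hX with hX | hX
    · exact ⟨Y, by simp, symLe_iff.2 ⟨_, h1, hX⟩⟩
    · obtain ⟨Z, hZ, h⟩ := ih h2 hX
      exact ⟨Z, by simp [hZ], h⟩

theorem NtEquiv.refl (X : G.NT) : NtEquiv G X X := ⟨SymLe.refl _, SymLe.refl _⟩

theorem NtEquiv.symm {X Y : G.NT} (h : NtEquiv G X Y) : NtEquiv G Y X := ⟨h.2, h.1⟩

theorem NtEquiv.trans {X Y Z : G.NT} (h : NtEquiv G X Y) (h' : NtEquiv G Y Z) : NtEquiv G X Z :=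
  ⟨h.1.trans h'.1, h'.2.trans h.2⟩

/-- `X ⇒* u Y α` for some sentential form `α`. -/
def Reaches (G : ContextFreeGrammar T) (X : G.NT) (u : List T) (Y : G.NT) : Prop :=
  ∃ α, G.Derives [Symbol.nonterminal X] (u.map Symbol.terminal ++ Symbol.nonterminal Y :: α)

/-- `X ⇒⁺ u X α` for some sentential form `α`. -/
def Loop (G : ContextFreeGrammar T) (X : G.NT) (u : List T) : Prop :=
  ∃ α, DerivesPlus G [Symbol.nonterminal X]
    (u.map Symbol.terminal ++ Symbol.nonterminal X :: α)

theorem derives_concat {X Y : G.NT} {u v : List T} {α β : List (Symbol T G.NT)}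
    (h : G.Derives [Symbol.nonterminal X] (v.map Symbol.terminal ++ Symbol.nonterminal Y :: β)) :
    G.Derives (u.map Symbol.terminal ++ Symbol.nonterminal X :: α)
      ((u ++ v).map Symbol.terminal ++ Symbol.nonterminal Y :: (β ++ α)) := by
  simpa using (h.append_right α).append_left (u.map Symbol.terminal)

theorem Reaches.trans {X Y Z : G.NT} {u v : List T} (h : Reaches G X u Y) (h' : Reaches G Y v Z) :
    Reaches G X (u ++ v) Z := by
  obtain ⟨α, h⟩ := h
  obtain ⟨β, h'⟩ := h'
  exact ⟨β ++ α, h.trans (derives_concat h')⟩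

theorem Loop.reaches {X : G.NT} {u : List T} (h : Loop G X u) : Reaches G X u X := by
  obtain ⟨α, h⟩ := h
  exact ⟨α, h.to_reflTransGen⟩

theorem Loop.append_reaches {X : G.NT} {u v : List T} (h : Loop G X u) (h' : Reaches G X v X) :
    Loop G X (u ++ v) := by
  obtain ⟨α, h⟩ := h
  obtain ⟨β, h'⟩ := h'
  exact ⟨β ++ α, h.trans_left (derives_concat h')⟩

theorem Reaches.wordPow {X : G.NT} {u : List T} (h : Reaches G X u X) (k : ℕ) :
    Reaches G X (wordPow u k) X := by
  induction k with
  | zero => exact ⟨[], .refl _⟩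
  | succ k ih =>
    rw [wordPow_succ]
    exact h.trans ih

end Derivations

/-! ### Rigidity of loops in ordinal grammars in normal form. -/

section NormalForm

universe u
variable {T : Type u} {G : ContextFreeGrammar T}

theorem IsNormalForm.lang_nonempty (hN : IsNormalForm G) (α : List (Symbol T G.NT)) :
    (lang G α).Nonempty := by
  induction α with
  | nil => exact ⟨[], .refl _⟩
  | cons Y α ih =>
    rw [lang_cons]
    refine Set.Nonempty.image2 ?_ ih
    cases Y with
    | terminal a => exact ⟨[a], .refl _⟩
    | nonterminal X => exact hN.productive X

theorem IsNormalForm.reaches_of_derives (hN : IsNormalForm G) {X Y : G.NT}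
    {α β : List (Symbol T G.NT)}
    (h : G.Derives [Symbol.nonterminal X] (α ++ Symbol.nonterminal Y :: β)) :
    ∃ u, Reaches G X u Y := by
  obtain ⟨u, hu⟩ := hN.lang_nonempty α
  exact ⟨u, β, h.trans (ContextFreeGrammar.Derives.append_right hu _)⟩

theorem IsNormalForm.exists_reaches (hN : IsNormalForm G) {X Y : G.NT} (h : NtEquiv G Y X) :
    ∃ u, Reaches G X u Y := by
  obtain ⟨⟨α, β, h⟩, -⟩ := h
  exact hN.reaches_of_derives h

theorem IsNormalForm.exists_loop (hN : IsNormalForm G) {X : G.NT} (h : IsRecursive G X) :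
    ∃ u, Loop G X u := by
  obtain ⟨α, β, h⟩ := h
  obtain ⟨u, hu⟩ := hN.lang_nonempty α
  exact ⟨u, β, h.trans_left (ContextFreeGrammar.Derives.append_right hu _)⟩

theorem IsNormalForm.lang_subset_of_reaches (hN : IsNormalForm G) {X Y : G.NT} {u : List T}
    (h : Reaches G X u Y) : ∃ z, ∀ w ∈ lang G [Symbol.nonterminal Y],
      u ++ (w ++ z) ∈ lang G [Symbol.nonterminal X] := by
  obtain ⟨α, h⟩ := h
  obtain ⟨z, hz⟩ := hN.lang_nonempty α
  refine ⟨z, fun w hw => lang_mono h ?_⟩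
  rw [lang_append, lang_cons, lang_terminals]
  exact ⟨u, rfl, _, ⟨w, hw, z, hz, rfl⟩, rfl⟩

theorem IsNormalForm.ne_nil_of_loop (hN : IsNormalForm G) {X : G.NT} {u : List T}
    (h : Loop G X u) : u ≠ [] := by
  rintro rfl
  obtain ⟨α, h⟩ := h
  obtain ⟨γ, h1, h2⟩ := Relation.TransGen.head'_iff.1 h
  obtain ⟨a, δ, hδ⟩ := hN.greibach _ (produces_nonterminal_iff.1 h1)
  obtain rfl : γ = _ := hδ
  obtain ⟨γ₁, γ₂, he, h3, -⟩ := derives_append_split (α := [a].map Symbol.terminal) h2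
  rw [derives_terminals h3] at he
  simp at he

theorem isRecursive_of_ntEquiv {X Y : G.NT} (hX : IsRecursive G X) (h : NtEquiv G Y X) :
    IsRecursive G Y := by
  obtain ⟨⟨α, β, h1⟩, ⟨γ, δ, h2⟩⟩ := h
  obtain ⟨ε, ζ, h3⟩ := hX
  refine ⟨γ ++ ε ++ α, β ++ ζ ++ δ, Relation.TransGen.trans_right h2 ?_⟩
  have h4 : DerivesPlus G (γ ++ [Symbol.nonterminal X] ++ δ)
      (γ ++ (ε ++ Symbol.nonterminal X :: ζ) ++ δ) :=
    Relation.TransGen.lift (r := G.Produces) (p := G.Produces) (fun x => γ ++ x ++ δ)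
      (fun _ _ h => (h.append_left γ).append_right δ) _ _ h3
  have h5 := ((h1.append_right ζ).append_left ε |>.append_right δ).append_left γ
  have h6 := h4.trans_left (c := γ ++ (ε ++ ((α ++ Symbol.nonterminal Y :: β) ++ ζ) ++ δ))
    (by simpa using h5)
  simpa using h6

theorem IsComponent.exists_symEquiv {X : G.NT} {γ : List (Symbol T G.NT)}
    (h : IsComponent G X γ) : ∃ Y ∈ γ, SymEquiv G Y (Symbol.nonterminal X) := by
  obtain ⟨hr, h⟩ := h
  simp only [IsEscaping, hr, true_and, not_forall, SymLt, not_and_or, not_not] at h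
  obtain ⟨Y, hY, h | h⟩ := h
  · exact absurd (symLe_iff.2 ⟨γ, (derives_of_rule hr).to_reflTransGen, hY⟩) h
  · exact ⟨Y, hY, h⟩

theorem isComponent_of_symLe {X : G.NT} {γ : List (Symbol T G.NT)} (hr : ⟨X, γ⟩ ∈ G.rules)
    {Y : Symbol T G.NT} (hY : Y ∈ γ) (h : SymLe G (Symbol.nonterminal X) Y) :
    IsComponent G X γ :=
  ⟨hr, fun he => (he.2 Y hY).2 ⟨(he.2 Y hY).1, h⟩⟩

theorem IsRecursive.exists_isComponent {X : G.NT} (hX : IsRecursive G X) :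
    ∃ γ, IsComponent G X γ := by
  obtain ⟨α, β, h⟩ := hX
  obtain ⟨γ, h1, h2⟩ := Relation.TransGen.head'_iff.1 h
  obtain ⟨Y, hY, h3⟩ := exists_symLe_of_derives h2 (X := Symbol.nonterminal X) (by simp)
  exact ⟨γ, isComponent_of_symLe (produces_nonterminal_iff.1 h1) hY h3⟩

theorem exists_terminals_or_nonterminal_mem {N : Type*} (γ : List (Symbol T N)) :
    (∃ u : List T, γ = u.map Symbol.terminal) ∨ ∃ Z, Symbol.nonterminal Z ∈ γ := by
  induction γ with
  | nil => exact .inl ⟨[], rfl⟩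
  | cons Y γ ih =>
    rcases ih with ⟨u, rfl⟩ | ⟨Z, hZ⟩
    · cases Y with
      | terminal a => exact .inl ⟨a :: u, rfl⟩
      | nonterminal Z => exact .inr ⟨Z, by simp⟩
    · exact .inr ⟨Z, by simp [hZ]⟩

variable [LinearOrder T]

theorem IsOrdinalGrammar.prefixFree (hG : IsOrdinalGrammar G) (α : List (Symbol T G.NT)) :
    PrefixFree (lang G α) := by
  induction α with
  | nil =>
    rw [show lang G [] = {[]} from lang_terminals []]
    rintro v rfl w rfl -
    rfl
  | cons Y α ih =>
    rw [lang_cons]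
    refine PrefixFree.concat ?_ ih
    cases Y with
    | terminal a =>
      rw [show lang G [Symbol.terminal a] = {[a]} from lang_terminals [a]]
      rintro v rfl w rfl -
      rfl
    | nonterminal X => exact (hG X).2

theorem IsOrdinalGrammar.isWF (hG : IsOrdinalGrammar G) (α : List (Symbol T G.NT)) :
    (lang G α).IsWF := by
  induction α with
  | nil =>
    rw [show lang G [] = {[]} from lang_terminals []]
    exact Set.isWF_singleton
  | cons Y α ih =>
    rw [lang_cons]
    refine (otype_concat ?_ (hG.prefixFree _) ih).1
    cases Y with
    | terminal a =>
      rw [show lang G [Symbol.terminal a] = {[a]} from lang_terminals [a]]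
      exact Set.isWF_singleton
    | nonterminal X =>
      obtain ⟨o, ho⟩ := (hG X).1
      exact (hasOrderType_iff.1 ho).1

theorem IsOrdinalGrammar.otype_append (hG : IsOrdinalGrammar G) (α β : List (Symbol T G.NT)) :
    otype (lang G (α ++ β)) = otype (lang G β) * otype (lang G α) := by
  rw [lang_append]
  exact (otype_concat (hG.isWF _) (hG.prefixFree _) (hG.isWF _)).2

theorem IsOrdinalGrammar.otype_cons (hG : IsOrdinalGrammar G) (Y : Symbol T G.NT)
    (β : List (Symbol T G.NT)) :
    otype (lang G (Y :: β)) = otype (lang G β) * otype (lang G [Y]) :=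
  hG.otype_append [Y] β

theorem IsOrdinalGrammar.otype_lang_pos (hG : IsOrdinalGrammar G) (hN : IsNormalForm G)
    (α : List (Symbol T G.NT)) : 0 < otype (lang G α) :=
  otype_pos (hG.isWF α) (hN.lang_nonempty α)

theorem IsOrdinalGrammar.otype_lang_le (hG : IsOrdinalGrammar G) {α β : List (Symbol T G.NT)}
    (h : G.Derives α β) : otype (lang G β) ≤ otype (lang G α) :=
  otype_mono (hG.isWF α) (lang_mono h)

theorem IsOrdinalGrammar.otype_append_nonterminal_le (hG : IsOrdinalGrammar G) (hN : IsNormalForm G)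
    (α β : List (Symbol T G.NT)) (Y : G.NT) :
    otype (lang G β) * otype (lang G [Symbol.nonterminal Y]) ≤
      otype (lang G (α ++ Symbol.nonterminal Y :: β)) := by
  rw [hG.otype_append, hG.otype_cons (Symbol.nonterminal Y) β]
  exact Ordinal.le_mul_left _ (hG.otype_lang_pos hN _)

/-- Deriving αYβ from X makes o(L(Y)) a factor of a lower bound for o(L(X)); hence order types are
constant on components. -/
theorem IsOrdinalGrammar.otype_le_of_symLe (hG : IsOrdinalGrammar G) (hN : IsNormalForm G)
    {X Y : G.NT} (h : SymLe G (Symbol.nonterminal Y) (Symbol.nonterminal X)) :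
    otype (lang G [Symbol.nonterminal Y]) ≤ otype (lang G [Symbol.nonterminal X]) := by
  obtain ⟨α, β, h⟩ := h
  exact (Ordinal.le_mul_right _ (hG.otype_lang_pos hN β)).trans
    ((hG.otype_append_nonterminal_le hN α β Y).trans (hG.otype_lang_le h))

theorem IsOrdinalGrammar.otype_eq_of_ntEquiv (hG : IsOrdinalGrammar G) (hN : IsNormalForm G)
    {X Y : G.NT} (h : NtEquiv G Y X) :
    otype (lang G [Symbol.nonterminal Y]) = otype (lang G [Symbol.nonterminal X]) :=
  le_antisymm (hG.otype_le_of_symLe hN h.1) (hG.otype_le_of_symLe hN h.2)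

theorem not_strictLt_nil (w : List T) : ¬ StrictLt w [] := by
  rintro ⟨p, a, b, s, s', -, h, -⟩
  simp at h

/-- Either w already differs from u at a letter, or w = ux, and stripping u reduces the claim to x
and the power n - 1. This makes prepending u a strictly decreasing operation above u^ω. -/
theorem strictLt_append_self_of_wordPow {u : List T} (n : ℕ) {w : List T}
    (h : StrictLt (wordPow u n) w) : StrictLt (u ++ w) w := by
  induction n generalizing w with
  | zero =>
    obtain ⟨p, a, b, s, s', h, -, -⟩ := h
    simp at h
  | succ n ih =>
    have hu : u <+: wordPow u (n + 1) := by simp [wordPow_succ]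
    rcases strictLt_trichotomy u w with h' | h' | h' | h'
    · simpa using h'.append_right w []
    · exact absurd (h'.of_prefix List.prefix_rfl hu).lt h.lt.asymm
    · obtain ⟨x, rfl⟩ := h'
      rw [wordPow_succ] at h
      refine (ih ?_).append_left u
      obtain ⟨q, a, b, s, s', h1, h2, hab⟩ := h
      rcases strictLt_trichotomy (wordPow u n) x with h' | h' | h' | h'
      · exact h'
      · exact absurd (h'.append_left u).lt
          (StrictLt.lt ⟨q, a, b, s, s', h1, h2, hab⟩).asymm
      · exact absurd (List.prefix_append_right_inj u |>.2 h')
          (StrictLt.not_prefix ⟨q, a, b, s, s', h1, h2, hab⟩)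
      · exact absurd (List.prefix_append_right_inj u |>.2 h')
          (StrictLt.not_prefix' ⟨q, a, b, s, s', h1, h2, hab⟩)
    · exact absurd (h'.trans hu) h.not_prefix'

theorem Loop.strictLtOmegaPow (hG : IsOrdinalGrammar G) (hN : IsNormalForm G) {X : G.NT}
    {u : List T} (hu : Loop G X u) {w : List T} (hw : w ∈ lang G [Symbol.nonterminal X]) :
    StrictLtOmegaPow w u := by
  have hne := hN.ne_nil_of_loop hu
  have key : ¬ w <+: wordPow u w.length := by
    intro h
    -- The exponent exceeds the length of w, so w would be a proper prefix of the pumped word.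
    obtain ⟨z, hz⟩ := hN.lang_subset_of_reaches (hu.reaches.wordPow (w.length + 1))
    have h1 : w <+: wordPow u (w.length + 1) ++ (w ++ z) :=
      (h.trans (wordPow_prefix u (Nat.le_succ _))).trans (List.prefix_append _ _)
    have h2 := congrArg List.length (hG.prefixFree _ _ hw _ (hz w hw) h1)
    have h3 := le_length_wordPow hne (w.length + 1)
    simp only [List.length_append] at h2
    omega
  rcases strictLt_trichotomy w (wordPow u w.length) with h | h | h | h
  · exact ⟨_, h⟩
  · exfalso
    -- The words of L(X) above u^ω: if m is the least of them, pumping gives umz, which is again in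
    -- `D` but smaller than m.
    let D : Set (List T) := {w ∈ lang G [Symbol.nonterminal X] | ∃ n, StrictLt (wordPow u n) w}
    have hD : D.IsWF := (hG.isWF [Symbol.nonterminal X]).mono (Set.sep_subset _ _)
    have hDne : D.Nonempty := ⟨w, hw, _, h⟩
    obtain ⟨hm, n, hn⟩ := hD.min_mem hDne
    obtain ⟨z, hz⟩ := hN.lang_subset_of_reaches hu.reaches
    refine hD.not_lt_min hDne (a := u ++ (hD.min hDne ++ z)) ⟨hz _ hm, n + 1, ?_⟩ ?_
    · rw [wordPow_succ]
      exact (hn.of_prefix List.prefix_rfl (List.prefix_append _ _)).append_left u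
    · have := (strictLt_append_self_of_wordPow n hn).append_right z []
      simpa using this.lt
  · exact absurd h key
  · rw [h.eq_of_length_le (le_length_wordPow hne _)] at key
    exact absurd List.prefix_rfl key

/-- L(X) has a word starting with vu, yet uv is itself a loop, so that word must lie below (uv)^ω.
-/
theorem Loop.not_strictLt_append (hG : IsOrdinalGrammar G) (hN : IsNormalForm G) {X : G.NT}
    {u v : List T} (hu : Loop G X u) (hv : Loop G X v) : ¬ StrictLt (u ++ v) (v ++ u) := by
  intro h
  obtain ⟨w, hw⟩ := hN.productive X
  obtain ⟨z, hz⟩ := hN.lang_subset_of_reaches (hv.append_reaches hu.reaches).reaches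
  obtain ⟨k, hk⟩ := (hu.append_reaches hv.reaches).strictLtOmegaPow hG hN (hz w hw)
  cases k with
  | zero => exact not_strictLt_nil _ hk
  | succ k =>
    rw [wordPow_succ] at hk
    exact hk.lt.asymm (h.append_right _ _).lt

theorem Loop.comm (hG : IsOrdinalGrammar G) (hN : IsNormalForm G) {X : G.NT} {u v : List T}
    (hu : Loop G X u) (hv : Loop G X v) : u ++ v = v ++ u := by
  have hl : (u ++ v).length = (v ++ u).length := by simp [Nat.add_comm]
  rcases strictLt_trichotomy (u ++ v) (v ++ u) with h | h | h | h
  · exact absurd h (hu.not_strictLt_append hG hN hv)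
  · exact absurd h (hv.not_strictLt_append hG hN hu)
  · exact h.eq_of_length hl
  · exact (h.eq_of_length hl.symm).symm

theorem exists_isLoopWord (hG : IsOrdinalGrammar G) (hN : IsNormalForm G) {X : G.NT}
    (hX : IsRecursive G X) : ∃ v, IsLoopWord G X v := by
  obtain ⟨x, hx⟩ := hN.exists_loop hX
  obtain ⟨v, hv, hroot⟩ := exists_root (hN.ne_nil_of_loop hx)
  refine ⟨v, hv, fun w hw => ?_, fun u α hu => ?_⟩
  · obtain ⟨k, rfl⟩ := hroot x rfl
    obtain ⟨j, hj⟩ := hx.strictLtOmegaPow hG hN hw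
    exact ⟨k * j, by rwa [wordPow_mul]⟩
  · have hu' : Loop G X u := ⟨α, hu⟩
    obtain ⟨k, rfl⟩ := hroot u (hu'.comm hG hN hx)
    refine ⟨k, ?_, rfl⟩
    rcases Nat.eq_zero_or_pos k with rfl | h
    · exact absurd rfl (hN.ne_nil_of_loop hu')
    · exact h

/-- All words of L(γ) are loops of X and therefore commute; commuting words of a prefix-free
language coincide. -/
theorem eq_of_mem_lang_of_loop (hG : IsOrdinalGrammar G) (hN : IsNormalForm G)
    {X : G.NT} {γ δ : List (Symbol T G.NT)}
    (h : DerivesPlus G [Symbol.nonterminal X] (γ ++ Symbol.nonterminal X :: δ))  :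
    ∀ v ∈ lang G γ, ∀ w ∈ lang G γ, v = w := by
  have hl : ∀ v ∈ lang G γ, Loop G X v := fun v hv =>
    ⟨δ, h.trans_left (ContextFreeGrammar.Derives.append_right hv _)⟩
  intro v hv w hw
  exact ((hG.prefixFree γ).eq_of_append_eq hv hw ((hl v hv).comm hG hN (hl w hw))).1

/-- A nonterminal left of the recursive occurrence would put its infinite language inside a form γ
with X ⇒⁺ γX…, whose language has at most one word. -/
theorem IsComponent.exists_eq (hG : IsOrdinalGrammar G) (hN : IsNormalForm G) {X : G.NT}
    {γ : List (Symbol T G.NT)} (h : IsComponent G X γ) :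
    ∃ (u : List T) (Y : G.NT) (α : List (Symbol T G.NT)),
      γ = u.map Symbol.terminal ++ Symbol.nonterminal Y :: α ∧ NtEquiv G Y X := by
  obtain ⟨Y, hY, hYX⟩ := h.exists_symEquiv
  obtain ⟨γ₁, γ₂, rfl⟩ := List.append_of_mem hY
  cases Y with
  | terminal a =>
    obtain ⟨α, β, h⟩ := hYX.2
    have := derives_terminals (u := [a]) h
    have h' : Symbol.nonterminal X ∈ [a].map (Symbol.terminal : T → Symbol T G.NT) := by
      rw [← this]
      simp
    simp at h'
  | nonterminal Y =>
    rcases exists_terminals_or_nonterminal_mem γ₁ with ⟨u, rfl⟩ | ⟨Z, hZ⟩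
    · exact ⟨u, Y, γ₂, rfl, hYX⟩
    · exfalso
      obtain ⟨α, β, hα⟩ := hYX.2
      have hd : DerivesPlus G [Symbol.nonterminal X]
          ((γ₁ ++ α) ++ Symbol.nonterminal X :: (β ++ γ₂)) := by
        refine (derives_of_rule h.1).trans_left ?_
        simpa using (hα.append_right γ₂).append_left γ₁
      obtain ⟨δ, ε, rfl⟩ := List.append_of_mem hZ
      have key := eq_of_mem_lang_of_loop hG hN hd
      obtain ⟨p, hp⟩ := hN.lang_nonempty δ
      obtain ⟨q, hq⟩ := hN.lang_nonempty (ε ++ α)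
      obtain ⟨v, hv, w, hw, hne⟩ := (hN.infinite Z).nontrivial
      apply hne
      have hmem : ∀ x ∈ lang G [Symbol.nonterminal Z],
          p ++ (x ++ q) ∈ lang G ((δ ++ Symbol.nonterminal Z :: ε) ++ α) := by
        intro x hx
        rw [List.append_assoc, lang_append, List.cons_append, lang_cons]
        exact ⟨p, hp, _, ⟨x, hx, q, hq, rfl⟩, rfl⟩
      simpa using key _ (hmem v hv) _ (hmem w hw)

end NormalForm

end OrdGrammar

namespace OrdGrammar

/-! ### Arithmetic of a^ω and of powers of `ω`. -/

section OrdinalArithmetic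

universe u
variable {a o : Ordinal.{u}}

theorem mul_opow_omega0 (a : Ordinal.{u}) : a * a ^ ω = a ^ ω := by
  conv_rhs => rw [← Ordinal.one_add_omega0, Ordinal.opow_add, Ordinal.opow_one]

theorem opow_omega0_le (ha : 1 ≤ a) (ho : 1 ≤ o) (h : a * o ≤ o) : a ^ ω ≤ o := by
  rw [Ordinal.opow_le_of_isSuccLimit (by positivity) Ordinal.isSuccLimit_omega0]
  intro b hb
  obtain ⟨n, rfl⟩ := Ordinal.lt_omega0.1 hb
  rw [Ordinal.opow_natCast]
  induction n with
  | zero => simpa using ho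
  | succ n ih =>
    rw [pow_succ']
    exact (mul_le_mul_right (ih (Ordinal.natCast_lt_omega0 _)) a).trans h

/-- For a > 1 the power a^ω is closed under addition: b < a^c gives b + b < a^c × 2 ≤ a^(c+1). So
a^ω can serve as a bound ω^f. -/
theorem exists_opow_omega0_eq (ha : 1 ≤ a) : ∃ g : Ordinal.{u}, a ^ ω = ω ^ g := by
  rcases ha.eq_or_lt with rfl | ha
  · exact ⟨0, by simp⟩
  have h0 : a ≠ 0 := (zero_lt_one.trans ha).ne'
  have h : Ordinal.IsPrincipal (· + ·) (a ^ ω) := by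
    rw [Ordinal.isPrincipal_add_iff_add_self_lt]
    intro b hb
    obtain ⟨c, hc, hbc⟩ :=
      (Ordinal.lt_opow_of_isSuccLimit h0 Ordinal.isSuccLimit_omega0).1 hb
    calc b + b < a ^ c + a ^ c := by
          exact (add_le_add_left hbc.le b).trans_lt (add_lt_add_right hbc _)
      _ = a ^ c * 2 := (Ordinal.mul_two _).symm
      _ ≤ a ^ c * a := mul_le_mul_right (by simpa [one_add_one_eq_two] using Order.succ_le_of_lt ha) _
      _ = a ^ Order.succ c := by simp
      _ ≤ a ^ ω := Ordinal.opow_le_opow_right (zero_lt_one.trans ha)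
          (Ordinal.isSuccLimit_omega0.succ_lt hc).le
  rcases Ordinal.isPrincipal_add_iff_zero_or_omega0_opow.1 h with h | ⟨g, hg⟩
  · exact absurd h (Ordinal.opow_pos _ (zero_lt_one.trans ha)).ne'
  · exact ⟨g, hg.symm⟩

/-- Since a × a^ω = a^ω and a^ω is a left factor of ω^f, left multiplication by a fixes ω^f. -/
theorem mul_lt_omega0_opow_of_opow_le {f : Ordinal.{u}} (ha : 1 ≤ a) (h : a ^ ω ≤ ω ^ f)
    (ho : o < ω ^ f) : a * o < ω ^ f := by
  obtain ⟨g, hg⟩ := exists_opow_omega0_eq ha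
  have hgf : g ≤ f := by
    rwa [hg, Ordinal.opow_le_opow_iff_right Ordinal.one_lt_omega0] at h
  have : a * ω ^ f = ω ^ f := by
    rw [← Ordinal.add_sub_cancel_of_le hgf, Ordinal.opow_add, ← mul_assoc, ← hg, mul_opow_omega0]
  rw [← this]
  exact mul_lt_mul_of_pos_left ho (zero_lt_one.trans_le ha)

theorem mul_omega0_eq_opow_succ_deg (ho : o ≠ 0) : o * ω = ω ^ Order.succ (deg o) := by
  apply le_antisymm
  · rw [Ordinal.mul_le_iff_of_isSuccLimit Ordinal.isSuccLimit_omega0]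
    intro b hb
    obtain ⟨n, rfl⟩ := Ordinal.lt_omega0.1 hb
    exact ((Ordinal.isPrincipal_add_omega0_opow _).mul_natCast_lt
      (Ordinal.lt_opow_succ_log_self Ordinal.one_lt_omega0 o) n).le
  · rw [Ordinal.opow_succ]
    exact mul_le_mul_left (Ordinal.opow_log_le_self ω ho) ω

end OrdinalArithmetic

/-! ### Existence of the two maxima. -/

section Maxima

universe u
variable {T : Type u} {G : ContextFreeGrammar T}

theorem trailingLangs_finite (X : G.NT) : (trailingLangs G X).Finite := by
  refine (G.rules.finite_toSet.biUnion
    (t := fun r => lang G '' {α | α ∈ r.output.tails}) fun r _ =>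
      (List.finite_toSet _).image _).subset ?_
  rintro L ⟨X', X'', u, α, -, -, h, rfl⟩
  refine Set.mem_biUnion h.1 ⟨α, ?_, rfl⟩
  exact List.mem_tails _ _ |>.2 ⟨u.map Symbol.terminal ++ [Symbol.nonterminal X''], by simp⟩

theorem escapingLangs_finite (X : G.NT) : (escapingLangs G X).Finite := by
  refine (G.rules.finite_toSet.image fun r => lang G r.output).subset ?_
  rintro L ⟨X', β, -, h, rfl⟩
  exact ⟨_, h.1, rfl⟩

theorem IsNormalForm.ne_nil_of_rule (hN : IsNormalForm G) {X Y : G.NT} {u : List T}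
    {α : List (Symbol T G.NT)}
    (h : ⟨X, u.map Symbol.terminal ++ Symbol.nonterminal Y :: α⟩ ∈ G.rules) : u ≠ [] := by
  rintro rfl
  obtain ⟨a, β, h⟩ := hN.greibach _ h
  simp at h

theorem lang_rule (u : List T) (Y : G.NT) (α : List (Symbol T G.NT)) :
    lang G (u.map Symbol.terminal ++ Symbol.nonterminal Y :: α) =
      (u ++ ·) '' concat (lang G [Symbol.nonterminal Y]) (lang G α) := by
  rw [lang_append, lang_cons, lang_terminals]
  exact Set.image2_singleton_left

/-- The words of `L` that do not extend `t`. -/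
def cut (L : Set (List T)) (t : List T) : Set (List T) := {w ∈ L | ¬ t <+: w}

theorem cut_subset (L : Set (List T)) (t : List T) : cut L t ⊆ L := Set.sep_subset _ _

variable [LinearOrder T]

theorem isMaxOrderType_iff {F : Set (Set (List T))} {o : Ordinal.{u}} (hF : ∀ L ∈ F, L.IsWF) :
    IsMaxOrderType F o ↔ (∃ L ∈ F, otype L = o) ∧ ∀ L ∈ F, otype L ≤ o := by
  constructor
  · rintro ⟨⟨L, hL, h⟩, h'⟩
    refine ⟨⟨L, hL, (hasOrderType_iff.1 h).2⟩, fun L hL => ?_⟩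
    obtain ⟨o', ho', h⟩ := h' L hL
    exact (hasOrderType_iff.1 h).2.trans_le ho'
  · rintro ⟨⟨L, hL, h⟩, h'⟩
    exact ⟨⟨L, hL, hasOrderType_iff.2 ⟨hF L hL, h⟩⟩,
      fun L hL => ⟨_, h' L hL, hasOrderType_iff.2 ⟨hF L hL, rfl⟩⟩⟩

theorem exists_isMaxOrderType {F : Set (Set (List T))} (hF : ∀ L ∈ F, L.IsWF) (hfin : F.Finite)
    (hne : F.Nonempty) : ∃ o, IsMaxOrderType F o := by
  obtain ⟨L, hL, h⟩ := Set.exists_max_image F otype hfin hne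
  exact ⟨otype L, (isMaxOrderType_iff hF).2 ⟨⟨L, hL, rfl⟩, h⟩⟩

theorem trailingLangs_nonempty (hG : IsOrdinalGrammar G) (hN : IsNormalForm G) {X : G.NT}
    (hX : IsRecursive G X) : (trailingLangs G X).Nonempty := by
  obtain ⟨γ, h⟩ := hX.exists_isComponent
  obtain ⟨u, Y, α, rfl, hY⟩ := h.exists_eq hG hN
  exact ⟨_, X, Y, u, α, .refl X, hY, h, rfl⟩

theorem escapingLangs_nonempty (hG : IsOrdinalGrammar G) (hN : IsNormalForm G) (X : G.NT) :
    (escapingLangs G X).Nonempty := by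
  -- Each component production strips a nonempty terminal prefix, so following a derivation inside
  -- the component shortens the word until an escaping production is used.
  have key : ∀ n, ∀ Y, NtEquiv G Y X → ∀ w ∈ lang G [Symbol.nonterminal Y], w.length = n →
      (escapingLangs G X).Nonempty := by
    intro n
    induction n using Nat.strong_induction_on with
    | _ n ih =>
      intro Y hY w hw hn
      obtain ⟨β, hr, hβ⟩ := mem_lang_nonterminal.1 hw
      by_cases he : IsEscaping G Y β
      · exact ⟨_, Y, β, hY, he, rfl⟩
      · obtain ⟨u, Z, α, rfl, hZ⟩ := IsComponent.exists_eq hG hN ⟨hr, he⟩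
        have hu := List.length_pos_iff.2 (hN.ne_nil_of_rule hr)
        rw [lang_rule] at hβ
        obtain ⟨_, ⟨v, hv, z, hz, rfl⟩, rfl⟩ := hβ
        refine ih v.length ?_ Z (hZ.trans hY) v hv rfl
        simp only [List.length_append] at hn
        omega
  obtain ⟨w, hw⟩ := hN.productive X
  exact key _ X (.refl X) w hw rfl

theorem isWF_of_mem_trailingLangs (hG : IsOrdinalGrammar G) {X : G.NT} :
    ∀ L ∈ trailingLangs G X, L.IsWF := by
  rintro L ⟨X', X'', u, α, -, -, h, rfl⟩
  exact hG.isWF α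

theorem isWF_of_mem_escapingLangs (hG : IsOrdinalGrammar G) {X : G.NT} :
    ∀ L ∈ escapingLangs G X, L.IsWF := by
  rintro L ⟨X', β, -, h, rfl⟩
  exact hG.isWF β

end Maxima

/-! ### Upper and lower bounds for the order type of L(X). -/

section Bounds

universe u
variable {T : Type u} [LinearOrder T] {G : ContextFreeGrammar T}

theorem IsLoopWord.eq_wordPow {X : G.NT} {v u : List T} (hv : IsLoopWord G X v)
    (hu : Loop G X u) : ∃ k, 1 ≤ k ∧ u = wordPow v k := by
  obtain ⟨α, hu⟩ := hu
  exact hv.loop u α hu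

theorem IsLoopWord.exists_loop (hN : IsNormalForm G) {X : G.NT} {v : List T}
    (hX : IsRecursive G X) (hv : IsLoopWord G X v) : ∃ k, 1 ≤ k ∧ Loop G X (wordPow v k) := by
  obtain ⟨s, hs⟩ := hN.exists_loop hX
  obtain ⟨k, hk, rfl⟩ := hv.eq_wordPow hs
  exact ⟨k, hk, hs⟩

/-- Taking the production, looping at Y and returning to X is a loop of X, hence a power of v. In
effect v^ω = u v'^ω, so loop words are compatible along productions. -/
theorem prefixOmega_append_wordPow (hN : IsNormalForm G) {X Y : G.NT} {u v v' : List T}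
    {α : List (Symbol T G.NT)} (hX : IsRecursive G X) (hYX : NtEquiv G Y X)
    (hr : ⟨X, u.map Symbol.terminal ++ Symbol.nonterminal Y :: α⟩ ∈ G.rules)
    (hv : IsLoopWord G X v) (hv' : IsLoopWord G Y v') (k : ℕ) :
    PrefixOmega (u ++ wordPow v' k) v := by
  obtain ⟨j, hj, hs⟩ := hv'.exists_loop hN (isRecursive_of_ntEquiv hX hYX)
  obtain ⟨r, hr'⟩ := hN.exists_reaches hYX.symm
  obtain ⟨β, hd⟩ := (hs.reaches.wordPow k).trans hr'
  have hl : Loop G X (u ++ (wordPow (wordPow v' j) k ++ r)) :=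
    ⟨β ++ α, (derives_of_rule hr).trans_left (derives_concat hd)⟩
  obtain ⟨i, -, hi⟩ := hv.eq_wordPow hl
  rw [← wordPow_mul] at hi
  refine ⟨i, hi ▸ ?_⟩
  rw [List.prefix_append_right_inj]
  exact (wordPow_prefix v' (Nat.le_mul_of_pos_left k hj)).trans (List.prefix_append _ _)

/-- Induction on the length of t. For Y → uZα, either u already extends t and nothing is left, or t
= ut' and the remaining words lie in u(cut of L(Z) at t')L(α), of type at most a × o for some o
below ω^f. -/
theorem otype_cut_lt (hG : IsOrdinalGrammar G) (hN : IsNormalForm G) {X : G.NT}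
    (hX : IsRecursive G X) {v : G.NT → List T}
    (hv : ∀ Y, NtEquiv G Y X → IsLoopWord G Y (v Y)) {a f : Ordinal.{u}}
    (ha : ∀ L ∈ trailingLangs G X, otype L ≤ a) (hf : ∀ o < ω ^ f, a * o < ω ^ f)
    (hesc : ∀ Y β t, NtEquiv G Y X → IsEscaping G Y β → PrefixOmega t (v Y) →
      otype (cut (lang G β) t) < ω ^ f) (n : ℕ) :
    ∀ t Y, t.length = n → NtEquiv G Y X → PrefixOmega t (v Y) →
      otype (cut (lang G [Symbol.nonterminal Y]) t) < ω ^ f := by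
  induction n using Nat.strong_induction_on with
  | _ n ih =>
    intro t Y hn hY ht
    have hsub : cut (lang G [Symbol.nonterminal Y]) t ⊆
        ⋃ r ∈ {r ∈ (G.rules : Set (ContextFreeRule T G.NT)) | r.input = Y},
          cut (lang G r.output) t := by
      rintro w ⟨hw, hwt⟩
      obtain ⟨β, hr, hβ⟩ := mem_lang_nonterminal.1 hw
      exact Set.mem_biUnion (x := ⟨Y, β⟩) ⟨hr, rfl⟩ ⟨hβ, hwt⟩
    have key := otype_biUnion_lt (e := f) (f := fun r => cut (lang G r.output) t)
      (G.rules.finite_toSet.subset (Set.sep_subset _ (fun r => r.input = Y))) ?_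
    · exact (otype_mono key.1 hsub).trans_lt key.2
    rintro ⟨Y', β⟩ ⟨hr, rfl⟩
    dsimp only at hY ht hr ⊢
    refine ⟨(hG.isWF β).mono (cut_subset _ _), ?_⟩
    by_cases he : IsEscaping G Y' β
    · exact hesc Y' β t hY he ht
    obtain ⟨u, Z, α, rfl, hZ⟩ := IsComponent.exists_eq hG hN ⟨hr, he⟩
    have hYrec := isRecursive_of_ntEquiv hX hY
    have hpre := prefixOmega_append_wordPow hN hYrec hZ hr (hv _ hY) (hv Z (hZ.trans hY))
    have hu := List.length_pos_iff.2 (hN.ne_nil_of_rule hr)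
    rw [lang_rule]
    rcases le_total t.length u.length with hl | hl
    · have htu : t <+: u := ht.prefix_of_length_le (by simpa using hpre 0) hl
      have : cut ((u ++ ·) '' concat (lang G [Symbol.nonterminal Z]) (lang G α)) t = ∅ := by
        rw [Set.eq_empty_iff_forall_notMem]
        rintro _ ⟨⟨w, -, rfl⟩, h⟩
        exact h (htu.trans (List.prefix_append _ _))
      rw [this, otype_empty]
      exact Ordinal.opow_pos _ Ordinal.omega0_pos
    · obtain ⟨t', rfl⟩ : u <+: t := PrefixOmega.prefix_of_length_le (by simpa using hpre 0) ht hl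
      have ht' : PrefixOmega t' (v Z) := by
        -- Any exponent making u v_Z^k at least as long as t works; both are prefixes of v_Y^ω.
        refine ⟨(u ++ t').length, ?_⟩
        rw [← List.prefix_append_right_inj u]
        refine ht.prefix_of_length_le (hpre _) ?_
        have := le_length_wordPow (hv Z (hZ.trans hY)).ne_nil (u ++ t').length
        simp only [List.length_append] at this ⊢
        omega
      have hlt := ih t'.length (by simp at hn; omega) t' Z rfl (hZ.trans hY) ht'
      have hcw : (cut (lang G [Symbol.nonterminal Z]) t').IsWF :=
        (hG.isWF _).mono (cut_subset _ _)
      have hcp : PrefixFree (cut (lang G [Symbol.nonterminal Z]) t') :=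
        fun x hx y hy h => hG.prefixFree _ x hx.1 y hy.1 h
      have hc := otype_concat hcw hcp (hG.isWF α)
      have hi := otype_image_append hc.1 u
      have hsub' : cut ((u ++ ·) '' concat (lang G [Symbol.nonterminal Z]) (lang G α)) (u ++ t') ⊆
          (u ++ ·) '' concat (cut (lang G [Symbol.nonterminal Z]) t') (lang G α) := by
        rintro _ ⟨⟨_, ⟨w, hw, z, hz, rfl⟩, rfl⟩, h⟩
        refine ⟨_, ⟨w, ⟨hw, fun h' => h ?_⟩, z, hz, rfl⟩, rfl⟩
        exact (List.prefix_append_right_inj u).2 (h'.trans (List.prefix_append _ _))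
      refine (otype_mono hi.1 hsub').trans_lt ?_
      rw [hi.2, hc.2]
      exact (mul_le_mul_left (ha _ ⟨Y', Z, u, α, hY, hZ.trans hY, ⟨hr, he⟩, rfl⟩) _).trans_lt
        (hf _ hlt)

/-- A word w is too short to extend the power |w| + 1 of the loop word, hence lies strictly below
it, and every word extending that power is above w. The initial segment below w is thus contained in
a cut. -/
theorem otype_le_omega0_opow (hG : IsOrdinalGrammar G) (hN : IsNormalForm G) {X : G.NT}
    (hX : IsRecursive G X) {v : G.NT → List T}
    (hv : ∀ Y, NtEquiv G Y X → IsLoopWord G Y (v Y)) {a f : Ordinal.{u}}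
    (ha : ∀ L ∈ trailingLangs G X, otype L ≤ a) (ha' : 1 ≤ a) (hf : a ^ ω ≤ ω ^ f)
    (hesc : ∀ Y β t, NtEquiv G Y X → IsEscaping G Y β → PrefixOmega t (v Y) →
      otype (cut (lang G β) t) < ω ^ f) :
    otype (lang G [Symbol.nonterminal X]) ≤ ω ^ f := by
  refine otype_le_of_forall (hG.isWF _) fun w hw => ?_
  have hvX := hv X (.refl X)
  refine (otype_mono ((hG.isWF _).mono (cut_subset _ _)) ?_).trans_lt
    (otype_cut_lt hG hN hX hv ha (fun o ho => mul_lt_omega0_opow_of_opow_le ha' hf ho) hesc _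
      (wordPow (v X) (w.length + 1)) X rfl (.refl X) (prefixOmega_wordPow _ _))
  rintro x ⟨hx, hxw⟩
  refine ⟨hx, fun h => ?_⟩
  have hlt := (hvX.lang_lt w hw).strictLt (prefixOmega_wordPow (v X) (w.length + 1)) fun h => by
    have := h.length_le
    have := le_length_wordPow hvX.ne_nil (w.length + 1)
    omega
  exact (hlt.lt.trans_le (le_of_prefix h)).asymm hxw

theorem opow_omega0_le_otype (hG : IsOrdinalGrammar G) (hN : IsNormalForm G) {X : G.NT}
    {L : Set (List T)} (hL : L ∈ trailingLangs G X) :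
    otype L ^ ω ≤ otype (lang G [Symbol.nonterminal X]) := by
  obtain ⟨Y, Z, u, α, hY, hZ, hr, rfl⟩ := hL
  refine opow_omega0_le (Order.one_le_iff_pos.2 (hG.otype_lang_pos hN _))
    (Order.one_le_iff_pos.2 (hG.otype_lang_pos hN _)) ?_
  have h := (hG.otype_append_nonterminal_le hN (u.map Symbol.terminal) α Z).trans
    (hG.otype_lang_le (derives_of_rule hr.1).to_reflTransGen)
  rwa [hG.otype_eq_of_ntEquiv hN hY, hG.otype_eq_of_ntEquiv hN hZ] at h

theorem otype_escaping_le (hG : IsOrdinalGrammar G) (hN : IsNormalForm G) {X : G.NT}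
    {L : Set (List T)} (hL : L ∈ escapingLangs G X) :
    otype L ≤ otype (lang G [Symbol.nonterminal X]) := by
  obtain ⟨Y, β, hY, hr, rfl⟩ := hL
  rw [← hG.otype_eq_of_ntEquiv hN hY]
  exact hG.otype_lang_le (derives_of_rule hr.1).to_reflTransGen

/-- The copies s^n A z_n lie in L(X) between s^n and s^(n+1), so they are stacked in increasing
order. -/
theorem mul_omega0_le_otype (hG : IsOrdinalGrammar G) (hN : IsNormalForm G) {X : G.NT}
    {s : List T} (hs : Reaches G X s X) {A : Set (List T)}
    (hA : A ⊆ lang G [Symbol.nonterminal X]) (hAs : ∀ w ∈ A, StrictLt w s) :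
    otype A * ω ≤ otype (lang G [Symbol.nonterminal X]) := by
  have hw := hG.isWF [Symbol.nonterminal X]
  have key : ∀ n : ℕ, otype A * n ≤
      otype (lang G [Symbol.nonterminal X] ∩ Set.Iio (wordPow s n)) := by
    intro n
    induction n with
    | zero => simp
    | succ n ih =>
      obtain ⟨z, hz⟩ := hN.lang_subset_of_reaches (hs.wordPow n)
      have hmono : StrictMonoOn (fun w => wordPow s n ++ (w ++ z)) A := fun x hx y hy h =>
        (((hG.prefixFree _).strictLt_of_lt (hA hx) (hA hy) h).append_right z z
          |>.append_left _).lt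
      obtain ⟨hi, hio⟩ := otype_eq_of_strictMonoOn_surjOn (hw.mono hA) hmono rfl
      rw [Nat.cast_succ, mul_add, mul_one]
      refine (add_le_add ih hio.ge).trans ?_
      rw [← otype_union_of_lt (hw.mono Set.inter_subset_left) hi]
      · refine otype_mono (hw.mono Set.inter_subset_left) (Set.union_subset ?_ ?_)
        · exact fun x hx => ⟨hx.1, hx.2.trans_le (le_of_prefix (wordPow_prefix s n.le_succ))⟩
        · rintro _ ⟨x, hx, rfl⟩
          refine ⟨hz x (hA hx), ?_⟩
          have := ((hAs x hx).append_right z []).append_left (wordPow s n)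
          rw [Set.mem_Iio, wordPow_add, wordPow_one]
          simpa using this.lt
      · rintro x hx _ ⟨y, hy, rfl⟩
        exact hx.2.trans_le (le_of_prefix (List.prefix_append _ _))
  rw [Ordinal.mul_le_iff_of_isSuccLimit Ordinal.isSuccLimit_omega0]
  intro b hb
  obtain ⟨n, rfl⟩ := Ordinal.lt_omega0.1 hb
  exact (key n).trans (otype_mono hw Set.inter_subset_left)

theorem mul_omega0_le_otype_of_cut (hG : IsOrdinalGrammar G) (hN : IsNormalForm G) {X : G.NT}
    (hX : IsRecursive G X) {v : List T} (hv : IsLoopWord G X v) {A : Set (List T)}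
    (hA : A ⊆ lang G [Symbol.nonterminal X]) (M : ℕ) (hAv : ∀ w ∈ A, ¬ wordPow v M <+: w) :
    otype A * ω ≤ otype (lang G [Symbol.nonterminal X]) := by
  obtain ⟨k, hk, hl⟩ := hv.exists_loop hN hX
  have hs := hl.reaches.wordPow M
  rw [← wordPow_mul] at hs
  refine mul_omega0_le_otype hG hN hs hA fun w hw => ?_
  refine (hv.lang_lt w (hA hw)).strictLt (prefixOmega_wordPow _ _) fun h => hAv w hw ?_
  exact (wordPow_prefix v (Nat.le_mul_of_pos_left M hk)).trans h

end Bounds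

/-! ### The three cases of the theorem. -/

section Cases

universe u
variable {T : Type u} [LinearOrder T] {G : ContextFreeGrammar T} {X : G.NT} {v : G.NT → List T}
  {a b : Ordinal.{u}}

theorem otype_eq_of_lt (hG : IsOrdinalGrammar G) (hN : IsNormalForm G) (hX : IsRecursive G X)
    (hv : ∀ Y, NtEquiv G Y X → IsLoopWord G Y (v Y))
    (ha : ∃ L ∈ trailingLangs G X, otype L = a) (ha' : ∀ L ∈ trailingLangs G X, otype L ≤ a)
    (ha1 : 1 ≤ a) (hb : ∀ L ∈ escapingLangs G X, otype L ≤ b) (hab : b < a ^ ω) :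
    otype (lang G [Symbol.nonterminal X]) = a ^ ω := by
  apply le_antisymm
  · obtain ⟨g, hg⟩ := exists_opow_omega0_eq ha1
    rw [hg] at hab ⊢
    refine otype_le_omega0_opow hG hN hX hv ha' ha1 hg.le fun Y β t hY he _ => ?_
    exact ((otype_mono (hG.isWF β) (cut_subset _ _)).trans (hb _ ⟨Y, β, hY, he, rfl⟩)).trans_lt hab
  · obtain ⟨L, hL, rfl⟩ := ha
    exact opow_omega0_le_otype hG hN hL

theorem otype_eq_of_escapingFollowLoops (hG : IsOrdinalGrammar G) (hN : IsNormalForm G)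
    (hX : IsRecursive G X) (hv : ∀ Y, NtEquiv G Y X → IsLoopWord G Y (v Y))
    (ha' : ∀ L ∈ trailingLangs G X, otype L ≤ a) (ha1 : 1 ≤ a)
    (hb : ∃ L ∈ escapingLangs G X, otype L = b) (hb' : ∀ L ∈ escapingLangs G X, otype L ≤ b)
    (hab : a ^ ω ≤ b) (hdeg : b = ω ^ deg b) (hfollow : EscapingFollowLoops G X v (deg b)) :
    otype (lang G [Symbol.nonterminal X]) = b := by
  apply le_antisymm
  · rw [hdeg]
    refine otype_le_omega0_opow hG hN hX hv ha' ha1 (hdeg ▸ hab) fun Y β t hY he ht => ?_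
    rw [← hdeg]
    rcases (hb' _ ⟨Y, β, hY, he, rfl⟩).lt_or_eq with h | h
    · exact (otype_mono (hG.isWF β) (cut_subset _ _)).trans_lt h
    have hinf := hfollow Y β b hY he (hasOrderType_iff.2 ⟨hG.isWF β, h⟩) rfl
    -- Some w in L(β) follows the loop beyond t. All words in the cut are below t, hence below w, so
    -- the cut sits in a proper initial segment of L(β).
    obtain ⟨N, ⟨w, hw, hNw⟩, hN'⟩ := hinf.exists_gt t.length
    have htw : t <+: w := by
      refine (ht.prefix_of_length_le (prefixOmega_wordPow _ N) ?_).trans hNw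
      exact hN'.le.trans (le_length_wordPow (hv Y hY).ne_nil N)
    rw [← h]
    refine (otype_mono ((hG.isWF β).mono Set.inter_subset_left) ?_).trans_lt
      (otype_inter_Iio_lt (hG.isWF β) hw)
    rintro x ⟨hx, hxt⟩
    refine ⟨hx, ?_⟩
    have hxX := lang_mono (derives_of_rule he.1).to_reflTransGen hx
    exact (((hv Y hY).lang_lt x hxX).strictLt ht hxt).lt.trans_le (le_of_prefix htw)
  · obtain ⟨L, hL, rfl⟩ := hb
    exact otype_escaping_le hG hN hL

theorem otype_eq_mul_omega0 (hG : IsOrdinalGrammar G) (hN : IsNormalForm G)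
    (hX : IsRecursive G X) (hv : ∀ Y, NtEquiv G Y X → IsLoopWord G Y (v Y))
    (ha' : ∀ L ∈ trailingLangs G X, otype L ≤ a) (ha1 : 1 ≤ a)
    (hb : ∃ L ∈ escapingLangs G X, otype L = b) (hb' : ∀ L ∈ escapingLangs G X, otype L ≤ b)
    (hb0 : b ≠ 0) (hab : a ^ ω ≤ b)
    (hnot : ¬ (b = ω ^ deg b ∧ EscapingFollowLoops G X v (deg b))) :
    otype (lang G [Symbol.nonterminal X]) = b * ω := by
  rw [mul_omega0_eq_opow_succ_deg hb0]
  have hlt : b < ω ^ Order.succ (deg b) :=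
    Ordinal.lt_opow_succ_log_self Ordinal.one_lt_omega0 b
  have hle : ω ^ deg b ≤ b := Ordinal.opow_log_le_self ω hb0
  apply le_antisymm
  · refine otype_le_omega0_opow hG hN hX hv ha' ha1 (hab.trans hlt.le) fun Y β t hY he _ => ?_
    exact ((otype_mono (hG.isWF β) (cut_subset _ _)).trans (hb' _ ⟨Y, β, hY, he, rfl⟩)).trans_lt hlt
  -- As b × ω = ω^(deg(b)+1), a set of type at least ω^deg(b) avoiding some power of the loop word
  -- suffices: it is pumped ω times.
  · suffices h : ∃ Y β A M, NtEquiv G Y X ∧ IsEscaping G Y β ∧ A ⊆ lang G β ∧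
        ω ^ deg b ≤ otype A ∧ ∀ w ∈ A, ¬ wordPow (v Y) M <+: w by
      obtain ⟨Y, β, A, M, hY, he, hA, hAo, hM⟩ := h
      rw [Ordinal.opow_succ, ← hG.otype_eq_of_ntEquiv hN hY]
      exact (mul_le_mul_left hAo ω).trans (mul_omega0_le_otype_of_cut hG hN
        (isRecursive_of_ntEquiv hX hY) (hv Y hY)
        (hA.trans (lang_mono (derives_of_rule he.1).to_reflTransGen)) M hM)
    by_cases hdeg : b = ω ^ deg b
    · have hnf : ¬ EscapingFollowLoops G X v (deg b) := fun h => hnot ⟨hdeg, h⟩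
      simp only [EscapingFollowLoops, not_forall] at hnf
      obtain ⟨Y, β, o, hY, he, ho, hod, hfin⟩ := hnf
      -- Here the whole of L(β) follows the loop at most M times.
      obtain ⟨M, hM⟩ := (Set.not_infinite.1 hfin).bddAbove
      refine ⟨Y, β, _, M + 1, hY, he, subset_rfl, ?_, fun w hw h => ?_⟩
      · rw [(hasOrderType_iff.1 ho).2, ← hod]
        refine Ordinal.opow_log_le_self ω ?_
        rw [← (hasOrderType_iff.1 ho).2]
        exact (hG.otype_lang_pos hN β).ne'
      · have := hM ⟨w, hw, h⟩
        omega
    · obtain ⟨L, ⟨Y, β, hY, he, rfl⟩, hL⟩ := hb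
      have hlt' : ω ^ deg b < otype (lang G β) := by
        rw [hL]
        exact lt_of_le_of_ne hle (Ne.symm hdeg)
      -- When b is not a power of ω, the element w of rank ω^deg(b) cuts off a segment of exactly
      -- that type, bounded by w and so away from the power |w| + 1.
      obtain ⟨w, hw, hwo⟩ := exists_otype_inter_Iio_eq (hG.isWF β) hlt'
      have hwX := lang_mono (derives_of_rule he.1).to_reflTransGen hw
      refine ⟨Y, β, _, w.length + 1, hY, he, Set.inter_subset_left, hwo.ge, ?_⟩
      rintro x ⟨-, hxw⟩ h
      have hlt := ((hv Y hY).lang_lt w hwX).strictLt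
        (prefixOmega_wordPow (v Y) (w.length + 1)) fun h => by
          have := h.length_le
          have := le_length_wordPow (hv Y hY).ne_nil (w.length + 1)
          omega
      exact (hlt.lt.trans_le (le_of_prefix h)).asymm hxw

end Cases

end OrdGrammar

theorem mainTheorem3 {T : Type*} [LinearOrder T] [Finite T]
    (G : ContextFreeGrammar T) [Finite G.NT]
    (hG : OrdGrammar.IsOrdinalGrammar G) (hN : OrdGrammar.IsNormalForm G)
    (X : G.NT) (hX : OrdGrammar.IsRecursive G X) :
    ∃ oα oβ : Ordinal,
      OrdGrammar.IsMaxOrderType (OrdGrammar.trailingLangs G X) oα ∧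
      OrdGrammar.IsMaxOrderType (OrdGrammar.escapingLangs G X) oβ ∧
      (∃ u : G.NT → List T, ∀ X', OrdGrammar.NtEquiv G X' X → OrdGrammar.IsLoopWord G X' (u X')) ∧
      ∀ u : G.NT → List T,
        (∀ X', OrdGrammar.NtEquiv G X' X → OrdGrammar.IsLoopWord G X' (u X')) →
        (oβ < oα ^ ω →
          OrdGrammar.HasOrderType (OrdGrammar.lang G [Symbol.nonterminal X]) (oα ^ ω)) ∧
        (oα ^ ω ≤ oβ → oβ = ω ^ OrdGrammar.deg oβ →
          OrdGrammar.EscapingFollowLoops G X u (OrdGrammar.deg oβ) →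
          OrdGrammar.HasOrderType (OrdGrammar.lang G [Symbol.nonterminal X]) oβ) ∧
        (oα ^ ω ≤ oβ →
          ¬ (oβ = ω ^ OrdGrammar.deg oβ ∧
            OrdGrammar.EscapingFollowLoops G X u (OrdGrammar.deg oβ)) →
          OrdGrammar.HasOrderType (OrdGrammar.lang G [Symbol.nonterminal X]) (oβ * ω)) := by
  have hwα := OrdGrammar.isWF_of_mem_trailingLangs hG (X := X)
  have hwβ := OrdGrammar.isWF_of_mem_escapingLangs hG (X := X)
  obtain ⟨oα, hα⟩ := OrdGrammar.exists_isMaxOrderType hwα (OrdGrammar.trailingLangs_finite X)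
    (OrdGrammar.trailingLangs_nonempty hG hN hX)
  obtain ⟨oβ, hβ⟩ := OrdGrammar.exists_isMaxOrderType hwβ (OrdGrammar.escapingLangs_finite X)
    (OrdGrammar.escapingLangs_nonempty hG hN X)
  obtain ⟨hα₁, hα₂⟩ := (OrdGrammar.isMaxOrderType_iff hwα).1 hα
  obtain ⟨hβ₁, hβ₂⟩ := (OrdGrammar.isMaxOrderType_iff hwβ).1 hβ
  have hα₀ : 1 ≤ oα := by
    obtain ⟨_, ⟨_, _, _, α, -, -, -, rfl⟩, rfl⟩ := hα₁
    exact Order.one_le_iff_pos.2 (hG.otype_lang_pos hN α)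
  have hβ₀ : oβ ≠ 0 := by
    obtain ⟨_, ⟨_, β, -, -, rfl⟩, rfl⟩ := hβ₁
    exact (hG.otype_lang_pos hN β).ne'
  refine ⟨oα, oβ, hα, hβ, ?_, fun u hu => ⟨fun h => ?_, fun h h' h'' => ?_, fun h h' => ?_⟩⟩
  · have h : ∀ Y, ∃ v, OrdGrammar.NtEquiv G Y X → OrdGrammar.IsLoopWord G Y v := by
      intro Y
      by_cases hY : OrdGrammar.NtEquiv G Y X
      · obtain ⟨v, hv⟩ := OrdGrammar.exists_isLoopWord hG hN
          (OrdGrammar.isRecursive_of_ntEquiv hX hY)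
        exact ⟨v, fun _ => hv⟩
      · exact ⟨[], fun h => absurd h hY⟩
    choose u hu using h
    exact ⟨u, hu⟩
  all_goals refine OrdGrammar.hasOrderType_iff.2 ⟨hG.isWF _, ?_⟩
  · exact OrdGrammar.otype_eq_of_lt hG hN hX hu hα₁ hα₂ hα₀ hβ₂ h
  · exact OrdGrammar.otype_eq_of_escapingFollowLoops hG hN hX hu hα₂ hα₀ hβ₁ hβ₂ h h' h''
  · exact OrdGrammar.otype_eq_mul_omega0 hG hN hX hu hα₂ hα₀ hβ₁ hβ₂ hβ₀ h h'
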